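/- Let $\mathbb T=\mathbb R/2\pi\mathbb Z$, with Haar measure $d\theta$ normalized to total mass one, and let $$\mathcal F f(\xi,j)=\int_{\mathbb R\times\mathbb T} f(x,\theta)\,e^{-i(x\xi+j\theta)}\,dx\,d\theta,\qquad (\xi,j)\in\mathbb R\times\mathbb Z,$$ be the Fourier transform on $\mathbb R\times\mathbb T$, extended to $L^2(\mathbb R\times\mathbb T)$ by Plancherel's theorem. For a bounded measurable function $m$ on $\mathbb R\times\mathbb Z$ let $T_m f=\mathcal F^{-1}(m\,\mathcal F f)$ for $f\in L^2(\mathbb R\times\mathbb T)$. Let $\mathcal C_2$ be the isometry of $L^2((0,\infty)\times\mathbb T)$ onto $L^2(\mathbb R\times\mathbb T)$ given by $(\mathcal C_2\varphi)(x,\theta)=e^{x/2}\varphi(e^x,\theta)$, and let $\chi_+$ be the characteristic function of $(0,\infty)$, acting in the first variable; $L^2((0,\infty)\times\mathbb T)$ is identified with the functions of $L^2(\mathbb R\times\mathbb T)$ that vanish for $x<0$. For $s\ge 0$ let $W^{s,2}(\mathbb R\times\mathbb T)$ be the space of all $f\in L^2(\mathbb R\times\mathbb T)$ such that $(1+\xi^2+j^2)^{s/2}\mathcal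 F f$ is square integrable on $\mathbb R\times\mathbb Z$, with the norm $$\|f\|_{W^{s,2}}=\big\|\mathcal F^{-1}\big[(1+\xi^2+j^2)^{s/2}\mathcal F f\big]\big\|_{L^2(\mathbb R\times\mathbb T)}.$$ For a real number $a$ with $|a|\ge\pi$ put $$m_a(\xi)=\frac{e^{a\xi}}{2\cosh(a\xi)},\qquad M_a(\xi,j)=e^{a/4}\,m_a\big(\xi-\tfrac j2-\tfrac14\big),\qquad Q_a=\chi_+\,\mathcal C_2^{-1}\,T_{M_a}\,\mathcal C_2\,\chi_+ .$$ **Theorem.** Let $a\in\mathbb R$ with $|a|\ge\pi$. For every $s\in\big[0,\frac{\pi}{2|a|}\big)$ the operator $Q_a$, defined on $L^2(\mathbb R\times\mathbb T)$, maps $W^{s,2}(\mathbb R\times\mathbb T)$ into itself and defines a bounded operator $Q_a: W^{s,2}(\mathbb R\times\mathbb T)\to W^{s,2}(\mathbb R\times\mathbb T)$. -/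

import Mathlib

namespace SobolevQ

noncomputable section

open MeasureTheory Set Filter
open scoped ENNReal Real SchwartzMap FourierTransform

section WeightedComp
variable {α β : Type*} [MeasurableSpace α] [MeasurableSpace β] {μ : Measure α} {ν : Measure β}

/-- `Φ` and `w` are such that the weighted composition `f ↦ w · (f ∘ Φ)` preserves the `L²` norm,
as a map from functions on `(α, μ)` to functions on `(β, ν)`: for every measurable `F ≥ 0`,
`∫ F(Φ y) |w y|² dν(y) = ∫ F dμ`. -/
structure IsL2Weight (μ : Measure α) (ν : Measure β) (Φ : β → α) (w : β → ℂ) : Prop where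
  meas_map : Measurable Φ
  meas_weight : Measurable w
  lintegral_eq : ∀ F : α → ℝ≥0∞, Measurable F →
    ∫⁻ y, F (Φ y) * ‖w y‖ₑ ^ 2 ∂ν = ∫⁻ x, F x ∂μ

namespace IsL2Weight
variable {Φ : β → α} {w : β → ℂ}

theorem eLpNorm_eq (h : IsL2Weight μ ν Φ w) {f : α → ℂ} (hf : Measurable f) :
    eLpNorm (fun y => w y * f (Φ y)) 2 ν = eLpNorm f 2 μ := by
  rw [eLpNorm_eq_lintegral_rpow_enorm_toReal (by norm_num) (by norm_num),
    eLpNorm_eq_lintegral_rpow_enorm_toReal (by norm_num) (by norm_num)]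
  congr 1
  rw [← h.lintegral_eq _ (by fun_prop)]
  refine lintegral_congr fun y => ?_
  simp [enorm_mul, mul_pow, mul_comm]

theorem ae_congr (h : IsL2Weight μ ν Φ w) {f g : α → ℂ} (hfg : f =ᵐ[μ] g) :
    (fun y => w y * f (Φ y)) =ᵐ[ν] fun y => w y * g (Φ y) := by
  set N := toMeasurable μ {x | ¬ f x = g x} with hN
  have hN0 : μ N = 0 := by rw [hN, measure_toMeasurable]; exact hfg
  have hNm : MeasurableSet N := measurableSet_toMeasurable _ _
  have h1 := h.lintegral_eq (N.indicator 1) (measurable_one.indicator hNm)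
  rw [lintegral_indicator_one hNm, hN0, lintegral_eq_zero_iff] at h1
  · filter_upwards [h1] with y hy
    by_cases hyN : Φ y ∈ N
    · have : w y = 0 := by simpa [hyN] using hy
      simp [this]
    · have : f (Φ y) = g (Φ y) := by
        by_contra hne
        exact hyN (subset_toMeasurable _ _ hne)
      rw [this]
  · exact ((measurable_one.indicator hNm).comp h.meas_map).mul (h.meas_weight.enorm.pow_const 2)

theorem memLp (h : IsL2Weight μ ν Φ w) (f : Lp ℂ 2 μ) :
    MemLp (fun y => w y * f (Φ y)) 2 ν := by
  have hf : Measurable (f : α → ℂ) := (Lp.stronglyMeasurable f).measurable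
  refine ⟨(h.meas_weight.mul (hf.comp h.meas_map)).aestronglyMeasurable, ?_⟩
  rw [h.eLpNorm_eq hf]
  exact Lp.eLpNorm_lt_top f

/-- The linear isometry `L²(μ) → L²(ν)`, `f ↦ w · (f ∘ Φ)`. -/
def isometry (h : IsL2Weight μ ν Φ w) : Lp ℂ 2 μ →ₗᵢ[ℂ] Lp ℂ 2 ν where
  toFun f := (h.memLp f).toLp
  map_add' f g := by
    rw [← MemLp.toLp_add]
    apply MemLp.toLp_congr
    filter_upwards [h.ae_congr (Lp.coeFn_add f g)] with y hy
    simp only [hy, Pi.add_apply, mul_add]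
  map_smul' c f := by
    rw [RingHom.id_apply, ← MemLp.toLp_const_smul]
    apply MemLp.toLp_congr
    filter_upwards [h.ae_congr (Lp.coeFn_smul c f)] with y hy
    simp only [hy, Pi.smul_apply, smul_eq_mul]
    ring
  norm_map' f := by
    have hf : Measurable (f : α → ℂ) := (Lp.stronglyMeasurable f).measurable
    change ‖(h.memLp f).toLp‖ = ‖f‖
    rw [Lp.norm_toLp, h.eLpNorm_eq hf, Lp.norm_def]

theorem coeFn_isometry (h : IsL2Weight μ ν Φ w) (f : Lp ℂ 2 μ) :
    h.isometry f =ᵐ[ν] fun y => w y * f (Φ y) :=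
  MemLp.coeFn_toLp (h.memLp f)

end IsL2Weight
end WeightedComp

section Tensor
variable {α β : Type*} [MeasurableSpace α] [MeasurableSpace β] {μ : Measure α} {ν : Measure β}

theorem lintegral_enorm_sq (b : Lp ℂ 2 ν) : ∫⁻ y, ‖b y‖ₑ ^ 2 ∂ν = ‖b‖ₑ ^ 2 := by
  rw [Lp.enorm_def, eLpNorm_eq_lintegral_rpow_enorm_toReal (by norm_num) (by norm_num)]
  simp only [ENNReal.toReal_ofNat, ENNReal.rpow_ofNat]
  rw [← ENNReal.rpow_natCast, ← ENNReal.rpow_mul]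
  simp

theorem isL2Weight_tensor [SFinite ν] (b : Lp ℂ 2 ν) (hb : ‖b‖ = 1) :
    IsL2Weight μ (μ.prod ν) Prod.fst (fun p : α × β => b p.2) where
  meas_map := measurable_fst
  meas_weight := (Lp.stronglyMeasurable b).measurable.comp measurable_snd
  lintegral_eq F hF := by
    have hbm : Measurable (b : β → ℂ) := (Lp.stronglyMeasurable b).measurable
    rw [lintegral_prod_mul hF.aemeasurable (hbm.enorm.pow_const 2).aemeasurable,
      lintegral_enorm_sq]
    simp [← ofReal_norm, hb]

/-- For a unit vector `b` of `L²(ν)`, the isometry `g ↦ g ⊗ b`, `(g ⊗ b)(x, y) = g(x) b(y)`,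
from `L²(μ)` to `L²(μ × ν)`. -/
def tensor [SFinite ν] (b : Lp ℂ 2 ν) (hb : ‖b‖ = 1) : Lp ℂ 2 μ →ₗᵢ[ℂ] Lp ℂ 2 (μ.prod ν) :=
  (isL2Weight_tensor b hb).isometry

theorem coeFn_tensor [SFinite ν] (b : Lp ℂ 2 ν) (hb : ‖b‖ = 1) (g : Lp ℂ 2 μ) :
    tensor (μ := μ) b hb g =ᵐ[μ.prod ν] fun p => b p.2 * g p.1 :=
  (isL2Weight_tensor b hb).coeFn_isometry g

theorem inner_tensor [SFinite μ] [SFinite ν] (b c : Lp ℂ 2 ν) (hb : ‖b‖ = 1) (hc : ‖c‖ = 1) (g h : Lp ℂ 2 μ) :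
    inner ℂ (tensor (μ := μ) b hb g) (tensor c hc h) = inner ℂ g h * inner ℂ b c := by
  rw [L2.inner_def, L2.inner_def, L2.inner_def, ← integral_prod_mul]
  refine integral_congr_ae ?_
  filter_upwards [coeFn_tensor b hb g, coeFn_tensor c hc h] with p h1 h2
  rw [h1, h2]
  simp only [RCLike.inner_apply, map_mul]
  ring

/-- If `(b i)` is a Hilbert basis of `L²(ν)`, then `L²(μ × ν)` is the Hilbert sum of the subspaces
`L²(μ) ⊗ b i`. -/
theorem isHilbertSum_tensor [SigmaFinite μ] [SFinite ν] {ι : Type*} [Countable ι] (b : HilbertBasis ι ℂ (Lp ℂ 2 ν)) :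
    IsHilbertSum ℂ (fun _ : ι => Lp ℂ 2 μ)
      (fun i => tensor (μ := μ) (b i) (b.orthonormal.1 i)) := by
  refine IsHilbertSum.mk ?_ ?_
  · intro i j hij g h
    rw [inner_tensor, b.orthonormal.2 hij, mul_zero]
  · rw [top_le_iff, Submodule.topologicalClosure_eq_top_iff, Submodule.eq_bot_iff]
    intro f hf
    have hfm : Measurable (f : α × β → ℂ) := (Lp.stronglyMeasurable f).measurable
    have horth : ∀ i (g : Lp ℂ 2 μ),
        inner ℂ (tensor (μ := μ) (b i) (b.orthonormal.1 i) g) f = 0 := fun i g =>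
      hf _ (Submodule.mem_iSup_of_mem i ⟨g, rfl⟩)
    have hc : ∀ i, ∀ᵐ x ∂μ, ∫ y, inner ℂ (b i y) (f (x, y)) ∂ν = 0 := by
      intro i
      have key : ∀ A : Set α, MeasurableSet A → μ A < ∞ →
          IntegrableOn (fun x => ∫ y, inner ℂ (b i y) (f (x, y)) ∂ν) A μ ∧
          ∫ x in A, ∫ y, inner ℂ (b i y) (f (x, y)) ∂ν ∂μ = 0 := by
        intro A hA hAfin
        set g : Lp ℂ 2 μ := indicatorConstLp 2 hA hAfin.ne 1 with hg
        have hae : (fun p => inner ℂ (tensor (μ := μ) (b i) (b.orthonormal.1 i) g p) (f p))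
            =ᵐ[μ.prod ν]
            fun p : α × β => A.indicator (fun _ => (1 : ℂ)) p.1 * inner ℂ (b i p.2) (f p) := by
          have h1 : (g : α → ℂ) =ᵐ[μ] A.indicator fun _ => (1 : ℂ) := indicatorConstLp_coeFn
          filter_upwards [coeFn_tensor (b i) (b.orthonormal.1 i) g,
            Measure.quasiMeasurePreserving_fst.ae_eq h1] with p h2 h3
          simp only [Function.comp_apply] at h3
          rw [h2, h3]
          by_cases hp : p.1 ∈ A <;> simp [hp]
        have hint := (integrable_congr hae).1
          (L2.integrable_inner (tensor (μ := μ) (b i) (b.orthonormal.1 i) g) f)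
        have hval := horth i g
        rw [L2.inner_def, integral_congr_ae hae, integral_prod _ hint] at hval
        have hint2 := hint.integral_prod_left
        have hEq : (fun x => ∫ y, A.indicator (fun _ => (1 : ℂ)) x * inner ℂ (b i y) (f (x, y)) ∂ν)
            = A.indicator (fun x => ∫ y, inner ℂ (b i y) (f (x, y)) ∂ν) := by
          funext x
          by_cases hx : x ∈ A <;> simp [hx]
        simp only [hEq] at hval hint2
        rw [integral_indicator hA] at hval
        exact ⟨(integrable_indicator_iff hA).1 hint2, hval⟩
      exact ae_eq_zero_of_forall_setIntegral_eq_of_sigmaFinite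
        (fun A hA hAfin => (key A hA hAfin).1) (fun A hA hAfin => (key A hA hAfin).2)
    have hfin : ∀ᵐ x ∂μ, ∫⁻ y, ‖f (x, y)‖ₑ ^ 2 ∂ν < ∞ := by
      refine ae_lt_top (hfm.enorm.pow_const 2).lintegral_prod_right' ?_
      rw [← lintegral_prod _ (hfm.enorm.pow_const 2).aemeasurable, lintegral_enorm_sq]
      simp [enorm_ne_top]
    have hzero : ∀ᵐ x ∂μ, ∀ᵐ y ∂ν, f (x, y) = 0 := by
      filter_upwards [hfin, ae_all_iff.2 hc] with x hx1 hx2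
      have hm : MemLp (fun y => f (x, y)) 2 ν := by
        refine ⟨(hfm.comp measurable_prodMk_left).aestronglyMeasurable, ?_⟩
        rw [eLpNorm_lt_top_iff_lintegral_rpow_enorm_lt_top (by norm_num) (by norm_num)]
        simpa using hx1
      have h0 : hm.toLp = 0 := by
        apply b.repr.injective
        ext i
        rw [b.repr_apply_apply, L2.inner_def, map_zero]
        refine Eq.trans (integral_congr_ae ?_) (hx2 i)
        filter_upwards [hm.coeFn_toLp] with y hy
        rw [hy]
      have h1 := hm.coeFn_toLp
      rw [h0] at h1
      filter_upwards [h1, Lp.coeFn_zero ℂ 2 ν] with y hy1 hy2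
      rw [← hy1, hy2]; rfl
    rw [Lp.eq_zero_iff_ae_eq_zero]
    have hs : MeasurableSet {p : α × β | ¬ f p = 0} :=
      (hfm (measurableSet_singleton 0)).compl
    exact (Measure.measure_prod_null hs).2 hzero

end Tensor

/-- The torus `𝕋 = ℝ / 2πℤ`, whose characters are `θ ↦ e^{ijθ}`, `j ∈ ℤ`. -/
abbrev Torus : Type := AddCircle (2 * π)

instance fact_two_pi_pos : Fact (0 < 2 * π) := ⟨Real.two_pi_pos⟩

/-- The measure `dx dθ` on `ℝ × 𝕋`, with `dθ` the Haar measure of total mass one on `𝕋`. -/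
abbrev measureRT : Measure (ℝ × Torus) :=
  (volume : Measure ℝ).prod AddCircle.haarAddCircle

/-- The space `L²(ℝ × 𝕋)`. -/
abbrev L2RT : Type := Lp ℂ 2 measureRT

/-- The measure `dξ / 2π` on the frequency line. -/
def measureFreq : Measure ℝ := ENNReal.ofReal (2 * π)⁻¹ • volume

instance : SigmaFinite measureFreq := by
  unfold measureFreq
  exact inferInstanceAs (SigmaFinite (Real.toNNReal (2 * π)⁻¹ • (volume : Measure ℝ)))

/-- The measure `(dξ / 2π) ⊗ (counting measure)` on `ℝ × ℤ`, dual to `dx dθ` on `ℝ × 𝕋`. -/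
abbrev measureRZ : Measure (ℝ × ℤ) := measureFreq.prod Measure.count

/-- The space `L²(ℝ × ℤ)`. -/
abbrev L2RZ : Type := Lp ℂ 2 measureRZ

theorem isL2Weight_toFreq :
    IsL2Weight volume measureFreq (fun ξ : ℝ => ξ / (2 * π)) (fun _ => 1) where
  meas_map := by fun_prop
  meas_weight := by fun_prop
  lintegral_eq F hF := by
    have h := lintegral_image_eq_lintegral_abs_deriv_mul (s := univ)
      (f := fun ξ : ℝ => ξ / (2 * π)) (f' := fun _ => 1 / (2 * π)) MeasurableSet.univ
      (fun x _ => ((hasDerivAt_id x).div_const _).hasDerivWithinAt)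
      (fun x _ y _ h => by
        have := Real.two_pi_pos.ne'
        field_simp at h; exact h) F
    rw [image_univ_of_surjective (fun y => ⟨y * (2 * π), by
      have := Real.two_pi_pos.ne'
      field_simp⟩), setLIntegral_univ, setLIntegral_univ,
      lintegral_const_mul _ (by fun_prop)] at h
    rw [h, measureFreq, lintegral_smul_measure, abs_of_pos (by positivity)]
    simp

theorem isL2Weight_ofFreq :
    IsL2Weight measureFreq volume (fun x : ℝ => 2 * π * x) (fun _ => 1) where
  meas_map := by fun_prop
  meas_weight := by fun_prop
  lintegral_eq F hF := by
    have h := isL2Weight_toFreq.lintegral_eq (fun x => F (2 * π * x)) (by fun_prop)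
    simp only [enorm_one, one_pow, mul_one] at h ⊢
    rw [← h]
    refine lintegral_congr fun x => ?_
    rw [mul_div_cancel₀ x Real.two_pi_pos.ne']

theorem toFreq_surjective : Function.Surjective isL2Weight_toFreq.isometry := by
  intro g
  refine ⟨isL2Weight_ofFreq.isometry g, Lp.ext ?_⟩
  filter_upwards [isL2Weight_toFreq.coeFn_isometry (isL2Weight_ofFreq.isometry g),
    isL2Weight_toFreq.ae_congr (isL2Weight_ofFreq.coeFn_isometry g)] with ξ h1 h2
  rw [h1, h2, one_mul, one_mul, mul_div_cancel₀ ξ Real.two_pi_pos.ne']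

/-- The Fourier transform on `L²(ℝ)`, with the normalization `ĝ(ξ) = ∫ g(x) e^{-ixξ} dx`.
Mathlib's Fourier transform has the kernel `e^{-2πixξ}`, hence the dilation by `2π`. -/
def fourierR : Lp ℂ 2 (volume : Measure ℝ) ≃ₗᵢ[ℂ] Lp ℂ 2 measureFreq :=
  (Lp.fourierTransformₗᵢ ℝ ℂ).trans
    (LinearIsometryEquiv.ofSurjective isL2Weight_toFreq.isometry toFreq_surjective)

theorem coeFn_fourierR (g : Lp ℂ 2 (volume : Measure ℝ)) :
    fourierR g =ᵐ[measureFreq] fun ξ => (Lp.fourierTransformₗᵢ ℝ ℂ g) (ξ / (2 * π)) := by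
  filter_upwards [isL2Weight_toFreq.coeFn_isometry (Lp.fourierTransformₗᵢ ℝ ℂ g)] with ξ h
  simpa [fourierR] using h

theorem fourierR_schwartz (g : 𝓢(ℝ, ℂ)) :
    fourierR (g.toLp 2) =ᵐ[measureFreq] fun ξ => ∫ x : ℝ, g x * Complex.exp (-(x * ξ : ℝ) * Complex.I) := by
  have h1 : Lp.fourierTransformₗᵢ ℝ ℂ (g.toLp 2) = (𝓕 g).toLp 2 := SchwartzMap.toLp_fourier_eq g
  have h2 := isL2Weight_toFreq.ae_congr ((𝓕 g).coeFn_toLp 2)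
  filter_upwards [coeFn_fourierR (g.toLp 2), h2] with ξ h3 h4
  rw [one_mul, one_mul] at h4
  rw [h3, h1, h4, SchwartzMap.fourier_coe, Real.fourier_eq']
  refine integral_congr_ae (Eventually.of_forall fun x => ?_)
  have : (-2 * π * inner ℝ x (ξ / (2 * π)) : ℝ) = -(x * ξ) := by
    have := Real.pi_pos.ne'
    simp only [RCLike.inner_apply, conj_trivial]
    field_simp
  simp only [this, smul_eq_mul, mul_comm (g x)]
  push_cast
  rfl

/-- The unit vector `δ_j` of `ℓ²(ℤ)`. -/
def delta (j : ℤ) : Lp ℂ 2 (Measure.count : Measure ℤ) :=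
  indicatorConstLp 2 (measurableSet_singleton j) (by simp) 1

theorem coeFn_delta (j k : ℤ) : delta j k = if k = j then 1 else 0 := by
  have h : ∀ᵐ k ∂(Measure.count : Measure ℤ), delta j k = ({j} : Set ℤ).indicator (fun _ => 1) k :=
    indicatorConstLp_coeFn
  rw [Measure.ae_count_iff] at h
  rw [h k, indicator_apply]
  simp

theorem inner_delta (j : ℤ) (f : Lp ℂ 2 (Measure.count : Measure ℤ)) :
    inner ℂ (delta j) f = f j := by
  rw [delta, L2.inner_indicatorConstLp_one]
  simp

theorem orthonormal_delta : Orthonormal ℂ delta := by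
  rw [orthonormal_iff_ite]
  intro i j
  rw [inner_delta, coeFn_delta]

/-- The standard Hilbert basis of `ℓ²(ℤ)`. -/
def deltaBasis : HilbertBasis ℤ ℂ (Lp ℂ 2 (Measure.count : Measure ℤ)) :=
  HilbertBasis.mkOfOrthogonalEqBot orthonormal_delta (by
    rw [Submodule.eq_bot_iff]
    intro f hf
    refine Lp.ext (Eventually.of_forall fun j => ?_)
    have h1 : f j = 0 := by
      rw [← inner_delta]
      exact hf _ (Submodule.subset_span ⟨j, rfl⟩)
    have h2 : ∀ᵐ k ∂(Measure.count : Measure ℤ), (0 : Lp ℂ 2 (Measure.count : Measure ℤ)) k = 0 :=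
      Lp.coeFn_zero _ _ _
    rw [Measure.ae_count_iff] at h2
    rw [h1, h2])


/-- The map `g ↦ g ⊗ e_j` from `L²(ℝ)` to `L²(ℝ × 𝕋)`, with `e_j(θ) = e^{ijθ}`. -/
def tensorRT (j : ℤ) : Lp ℂ 2 (volume : Measure ℝ) →ₗᵢ[ℂ] L2RT :=
  tensor (fourierBasis j) (fourierBasis.orthonormal.1 j)

/-- The map `h ↦ h ⊗ δ_j` from `L²(ℝ, dξ / 2π)` to `L²(ℝ × ℤ)`. -/
def tensorRZ (j : ℤ) : Lp ℂ 2 measureFreq →ₗᵢ[ℂ] L2RZ :=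
  tensor (deltaBasis j) (deltaBasis.orthonormal.1 j)

theorem coeFn_tensorRT (j : ℤ) (g : Lp ℂ 2 (volume : Measure ℝ)) :
    tensorRT j g =ᵐ[measureRT] fun p => fourier j p.2 * g p.1 := by
  have h : (fourierBasis j : Lp ℂ 2 (AddCircle.haarAddCircle (T := 2 * π)))
      =ᵐ[AddCircle.haarAddCircle] fourier j := by
    rw [coe_fourierBasis]
    exact coeFn_fourierLp 2 j
  filter_upwards [coeFn_tensor (μ := (volume : Measure ℝ)) (fourierBasis j)
    (fourierBasis.orthonormal.1 j) g, Measure.quasiMeasurePreserving_snd.ae_eq h] with p h1 h2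
  simp only [Function.comp_apply] at h2
  rw [tensorRT, h1, h2]

theorem coeFn_tensorRZ (j : ℤ) (g : Lp ℂ 2 measureFreq) :
    tensorRZ j g =ᵐ[measureRZ] fun p => if p.2 = j then g p.1 else 0 := by
  filter_upwards [coeFn_tensor (μ := measureFreq) (deltaBasis j)
    (deltaBasis.orthonormal.1 j) g] with p h1
  rw [tensorRZ, h1, deltaBasis, HilbertBasis.coe_mkOfOrthogonalEqBot, coeFn_delta]
  simp

theorem isHilbertSum_RT : IsHilbertSum ℂ (fun _ : ℤ => Lp ℂ 2 (volume : Measure ℝ)) tensorRT :=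
  isHilbertSum_tensor fourierBasis

theorem isHilbertSum_RZ : IsHilbertSum ℂ (fun _ : ℤ => Lp ℂ 2 (volume : Measure ℝ))
    (fun j => (tensorRZ j).comp fourierR.toLinearIsometry) := by
  have h : IsHilbertSum ℂ (fun _ : ℤ => Lp ℂ 2 measureFreq) tensorRZ :=
    isHilbertSum_tensor deltaBasis
  refine IsHilbertSum.mk (fun i j hij f g => h.OrthogonalFamily hij _ _) ?_
  have hr : ∀ j, LinearMap.range ((tensorRZ j).comp fourierR.toLinearIsometry).toLinearMap
      = LinearMap.range (tensorRZ j).toLinearMap := by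
    intro j
    ext x
    constructor
    · rintro ⟨y, rfl⟩
      exact ⟨fourierR y, rfl⟩
    · rintro ⟨y, rfl⟩
      exact ⟨fourierR.symm y, by simp⟩
  simp only [hr]
  rw [← h.OrthogonalFamily.range_linearIsometry]
  exact (LinearMap.range_eq_top.2 h.surjective_isometry).ge

/-- The Fourier transform (Plancherel) `ℱ : L²(ℝ × 𝕋) → L²(ℝ × ℤ)`,
`ℱ f(ξ, j) = ∫ f(x, θ) e^{-i(xξ + jθ)} dx dθ`. It is the unique bounded linear map which sends
`g ⊗ e_j` to `ĝ ⊗ δ_j` for all `g ∈ L²(ℝ)` and `j ∈ ℤ`. -/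
def fourierRT : L2RT ≃ₗᵢ[ℂ] L2RZ :=
  isHilbertSum_RT.linearIsometryEquiv.trans isHilbertSum_RZ.linearIsometryEquiv.symm

theorem fourierRT_tensor (j : ℤ) (g : Lp ℂ 2 (volume : Measure ℝ)) :
    fourierRT (tensorRT j g) = tensorRZ j (fourierR g) := by
  classical
  have h : isHilbertSum_RT.linearIsometryEquiv (tensorRT j g) =
      lp.single (E := fun _ : ℤ => Lp ℂ 2 (volume : Measure ℝ)) 2 j g := by
    rw [← LinearIsometryEquiv.eq_symm_apply]
    simp
  rw [fourierRT, LinearIsometryEquiv.trans_apply, h,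
    IsHilbertSum.linearIsometryEquiv_symm_apply_single]
  rfl

/-- The Fourier multiplier operator `T_m f = ℱ⁻¹ (m · ℱ f)` on `L²(ℝ × 𝕋)`, for an (essentially)
bounded measurable function `m` on `ℝ × ℤ`. -/
def multiplierOp (m : ℝ × ℤ → ℂ) (hm : MemLp m ∞ measureRZ) : L2RT →L[ℂ] L2RT :=
  (fourierRT.symm : L2RZ →L[ℂ] L2RT) ∘L
    (ContinuousLinearMap.mul ℂ ℂ).holderL measureRZ ∞ 2 2 hm.toLp ∘L
      (fourierRT : L2RT →L[ℂ] L2RZ)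

theorem fourierRT_multiplierOp (m : ℝ × ℤ → ℂ) (hm : MemLp m ∞ measureRZ) (f : L2RT) :
    fourierRT (multiplierOp m hm f) =ᵐ[measureRZ] fun p => m p * fourierRT f p := by
  have h : fourierRT (multiplierOp m hm f) =
      (ContinuousLinearMap.mul ℂ ℂ).holder 2 hm.toLp (fourierRT f) := by
    simp [multiplierOp]
  rw [h]
  filter_upwards [(ContinuousLinearMap.mul ℂ ℂ).coeFn_holder (r := 2) hm.toLp (fourierRT f),
    hm.coeFn_toLp] with p h1 h2
  rw [h1, h2]
  rfl

/-- The set `(0, ∞) × 𝕋`. -/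
abbrev halfStrip : Set (ℝ × Torus) := Ioi 0 ×ˢ univ

/-- The space `L²((0, ∞) × 𝕋)`. -/
abbrev L2Half : Type := Lp ℂ 2 (measureRT.restrict halfStrip)

theorem measurableSet_halfStrip : MeasurableSet halfStrip :=
  measurableSet_Ioi.prod MeasurableSet.univ

/-- Right-hand factor `χ₊`: the restriction `L²(ℝ × 𝕋) → L²((0, ∞) × 𝕋)`. -/
def restrictHalf : L2RT →L[ℂ] L2Half :=
  LpToLpRestrictCLM (ℝ × Torus) ℂ ℂ measureRT 2 halfStrip

theorem isL2Weight_extend :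
    IsL2Weight (measureRT.restrict halfStrip) measureRT id (halfStrip.indicator fun _ => 1) where
  meas_map := measurable_id
  meas_weight := measurable_const.indicator measurableSet_halfStrip
  lintegral_eq F hF := by
    rw [← lintegral_indicator measurableSet_halfStrip]
    refine lintegral_congr fun p => ?_
    by_cases hp : p ∈ halfStrip <;> simp only [hp, indicator_of_mem, indicator_of_notMem,
      not_false_eq_true] <;> simp

/-- Left-hand factor `χ₊`: the extension by zero `L²((0, ∞) × 𝕋) → L²(ℝ × 𝕋)`. -/
def extendHalf : L2Half →ₗᵢ[ℂ] L2RT := isL2Weight_extend.isometry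

theorem coeFn_extendHalf (f : L2Half) :
    extendHalf f =ᵐ[measureRT] halfStrip.indicator f := by
  filter_upwards [isL2Weight_extend.coeFn_isometry f] with p hp
  rw [extendHalf, hp]
  by_cases h : p ∈ halfStrip <;> simp only [h, indicator_of_mem, indicator_of_notMem,
      not_false_eq_true] <;> simp

theorem lintegral_exp_change (F : ℝ × Torus → ℝ≥0∞) (hF : Measurable F) :
    ∫⁻ p, ENNReal.ofReal (Real.exp p.1) * F (Real.exp p.1, p.2) ∂measureRT
      = ∫⁻ p in halfStrip, F p ∂measureRT := by
  have hr : measureRT.restrict halfStrip =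
      ((volume : Measure ℝ).restrict (Ioi 0)).prod AddCircle.haarAddCircle := by
    rw [← Measure.prod_restrict, Measure.restrict_univ]
  rw [hr, lintegral_prod_symm _ (by fun_prop), lintegral_prod_symm _ hF.aemeasurable]
  refine lintegral_congr fun θ => ?_
  have h := lintegral_image_eq_lintegral_abs_deriv_mul (s := univ) (f := Real.exp)
    (f' := Real.exp) MeasurableSet.univ
    (fun x _ => (Real.hasDerivAt_exp x).hasDerivWithinAt) Real.exp_injective.injOn
    (fun x => F (x, θ))
  rw [image_univ, Real.range_exp, setLIntegral_univ] at h
  rw [h]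
  simp only [abs_of_pos (Real.exp_pos _)]

theorem isL2Weight_C2 :
    IsL2Weight (measureRT.restrict halfStrip) measureRT (fun p => (Real.exp p.1, p.2))
      (fun p => (Real.exp (p.1 / 2) : ℂ)) where
  meas_map := by fun_prop
  meas_weight := by fun_prop
  lintegral_eq F hF := by
    rw [← lintegral_exp_change F hF]
    refine lintegral_congr fun p => ?_
    have : ‖(Real.exp (p.1 / 2) : ℂ)‖ₑ ^ 2 = ENNReal.ofReal (Real.exp p.1) := by
      rw [← ofReal_norm, ← ENNReal.ofReal_pow (norm_nonneg _), Complex.norm_real,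
        Real.norm_of_nonneg (Real.exp_pos _).le, ← Real.exp_nat_mul]
      congr 2
      push_cast
      ring
    rw [this, mul_comm]

theorem isL2Weight_C2inv :
    IsL2Weight measureRT (measureRT.restrict halfStrip) (fun p => (Real.log p.1, p.2))
      (fun p => (Real.exp (-(Real.log p.1 / 2)) : ℂ)) where
  meas_map := by fun_prop
  meas_weight := by fun_prop
  lintegral_eq F hF := by
    rw [← lintegral_exp_change _ (by fun_prop)]
    refine lintegral_congr fun p => ?_
    have : ‖(Real.exp (-(p.1 / 2)) : ℂ)‖ₑ ^ 2 = ENNReal.ofReal (Real.exp (-p.1)) := by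
      rw [← ofReal_norm, ← ENNReal.ofReal_pow (norm_nonneg _), Complex.norm_real,
        Real.norm_of_nonneg (Real.exp_pos _).le, ← Real.exp_nat_mul]
      congr 2
      push_cast
      ring
    simp only [Real.log_exp]
    rw [this, mul_left_comm, ← ENNReal.ofReal_mul (Real.exp_pos _).le, ← Real.exp_add]
    simp

theorem C2_surjective : Function.Surjective isL2Weight_C2.isometry := by
  intro g
  refine ⟨isL2Weight_C2inv.isometry g, Lp.ext ?_⟩
  filter_upwards [isL2Weight_C2.coeFn_isometry (isL2Weight_C2inv.isometry g),
    isL2Weight_C2.ae_congr (isL2Weight_C2inv.coeFn_isometry g)] with p h1 h2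
  rw [h1, h2]
  simp only [Real.log_exp, Prod.mk.eta]
  rw [← mul_assoc, ← Complex.ofReal_mul, ← Real.exp_add]
  simp

/-- The isometry `𝒞₂` of `L²((0, ∞) × 𝕋)` onto `L²(ℝ × 𝕋)`, `(𝒞₂ φ)(x, θ) = e^{x/2} φ(e^x, θ)`. -/
def C2 : L2Half ≃ₗᵢ[ℂ] L2RT :=
  LinearIsometryEquiv.ofSurjective isL2Weight_C2.isometry C2_surjective

theorem coeFn_C2 (f : L2Half) :
    C2 f =ᵐ[measureRT] fun p => (Real.exp (p.1 / 2) : ℂ) * f (Real.exp p.1, p.2) :=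
  isL2Weight_C2.coeFn_isometry f

/-- The symbol `m_a(ξ) = e^{aξ} / (2 cosh(aξ))`. -/
def mSymbol (a ξ : ℝ) : ℝ := Real.exp (a * ξ) / (2 * Real.cosh (a * ξ))

/-- The symbol `M_a(ξ, j) = e^{a/4} m_a(ξ - j/2 - 1/4)`. -/
def MSymbol (a ξ : ℝ) (j : ℤ) : ℝ := Real.exp (a / 4) * mSymbol a (ξ - j / 2 - 1 / 4)

theorem mSymbol_nonneg (a ξ : ℝ) : 0 ≤ mSymbol a ξ := by
  unfold mSymbol
  have := Real.cosh_pos (a * ξ)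
  positivity

theorem mSymbol_le_one (a ξ : ℝ) : mSymbol a ξ ≤ 1 := by
  unfold mSymbol
  have := Real.cosh_pos (a * ξ)
  rw [div_le_one (by positivity), Real.cosh_eq]
  linarith [Real.exp_pos (-(a * ξ))]

theorem memLp_MSymbol (a : ℝ) :
    MemLp (fun p : ℝ × ℤ => (MSymbol a p.1 p.2 : ℂ)) ∞ measureRZ := by
  refine memLp_top_of_bound ?_ (Real.exp (a / 4)) (Eventually.of_forall fun p => ?_)
  · unfold MSymbol mSymbol
    refine Measurable.aestronglyMeasurable ?_
    have : Measurable fun p : ℝ × ℤ => (p.2 : ℝ) := measurable_from_top.comp measurable_snd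
    fun_prop
  · rw [Complex.norm_real, MSymbol, norm_mul, Real.norm_of_nonneg (Real.exp_pos _).le,
      Real.norm_of_nonneg (mSymbol_nonneg _ _)]
    exact mul_le_of_le_one_right (Real.exp_pos _).le (mSymbol_le_one _ _)

/-- The operator `Q_a = χ₊ 𝒞₂⁻¹ T_{M_a} 𝒞₂ χ₊` on `L²(ℝ × 𝕋)`. -/
def opQ (a : ℝ) : L2RT →L[ℂ] L2RT :=
  extendHalf.toContinuousLinearMap ∘L (C2.symm : L2RT →L[ℂ] L2Half) ∘L
    multiplierOp (fun p => (MSymbol a p.1 p.2 : ℂ)) (memLp_MSymbol a) ∘L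
      (C2 : L2Half →L[ℂ] L2RT) ∘L restrictHalf

/-- The weight `(1 + ξ² + j²)^{s/2}`. -/
def besselWeight (s : ℝ) (p : ℝ × ℤ) : ℝ := (1 + p.1 ^ 2 + (p.2 : ℝ) ^ 2) ^ (s / 2)

theorem besselWeight_pos (s : ℝ) (p : ℝ × ℤ) : 0 < besselWeight s p := by
  unfold besselWeight
  positivity

/-- The functions `f ∈ L²(ℝ × 𝕋)` such that `(1 + ξ² + j²)^{s/2} ℱ f` is square integrable. -/
def sobolevSubmodule (s : ℝ) : Submodule ℂ L2RT where
  carrier := {f | MemLp (fun p => (besselWeight s p : ℂ) * fourierRT f p) 2 measureRZ}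
  zero_mem' := by
    refine (MemLp.zero (ε := ℂ)).ae_eq ?_
    rw [map_zero]
    filter_upwards [Lp.coeFn_zero ℂ 2 measureRZ] with p hp
    rw [hp]
    simp
  add_mem' {f g} hf hg := by
    refine (MemLp.add hf hg).ae_eq ?_
    rw [map_add]
    filter_upwards [Lp.coeFn_add (fourierRT f) (fourierRT g)] with p hp
    rw [hp]
    simp [mul_add]
  smul_mem' c f hf := by
    refine (MemLp.const_smul hf c).ae_eq ?_
    rw [map_smul]
    filter_upwards [Lp.coeFn_smul c (fourierRT f)] with p hp
    rw [hp]
    simp [mul_left_comm]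

/-- The Sobolev space `W^{s,2}(ℝ × 𝕋)`, for `s ≥ 0`, with the norm
`‖f‖ = ‖ℱ⁻¹ [(1 + ξ² + j²)^{s/2} ℱ f]‖_{L²(ℝ × 𝕋)}` introduced below. -/
def Sobolev (s : ℝ) : Type := sobolevSubmodule s

instance (s : ℝ) : AddCommGroup (Sobolev s) := inferInstanceAs (AddCommGroup (sobolevSubmodule s))

instance (s : ℝ) : Module ℂ (Sobolev s) := inferInstanceAs (Module ℂ (sobolevSubmodule s))

/-- The inclusion of `W^{s,2}(ℝ × 𝕋)` into `L²(ℝ × 𝕋)`. -/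
def Sobolev.toL2 {s : ℝ} : Sobolev s →ₗ[ℂ] L2RT := (sobolevSubmodule s).subtype

theorem Sobolev.memLp {s : ℝ} (f : Sobolev s) :
    MemLp (fun p => (besselWeight s p : ℂ) * fourierRT f.toL2 p) 2 measureRZ := f.2

/-- The operator `f ↦ ℱ⁻¹ [(1 + ξ² + j²)^{s/2} ℱ f]` from `W^{s,2}(ℝ × 𝕋)` to `L²(ℝ × 𝕋)`. -/
def besselPotential (s : ℝ) : Sobolev s →ₗ[ℂ] L2RT where
  toFun f := fourierRT.symm (f.memLp.toLp)
  map_add' f g := by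
    rw [← map_add, ← MemLp.toLp_add]
    congr 1
    apply MemLp.toLp_congr
    rw [map_add, map_add]
    filter_upwards [Lp.coeFn_add (fourierRT f.toL2) (fourierRT g.toL2)] with p hp
    rw [hp]
    simp [mul_add]
  map_smul' c f := by
    rw [RingHom.id_apply, ← map_smul, ← MemLp.toLp_const_smul]
    congr 1
    apply MemLp.toLp_congr
    rw [map_smul, map_smul]
    filter_upwards [Lp.coeFn_smul c (fourierRT f.toL2)] with p hp
    rw [hp]
    simp [mul_left_comm]

theorem fourierRT_besselPotential {s : ℝ} (f : Sobolev s) :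
    fourierRT (besselPotential s f) =ᵐ[measureRZ]
      fun p => (besselWeight s p : ℂ) * fourierRT f.toL2 p := by
  change fourierRT (fourierRT.symm (f.memLp.toLp)) =ᵐ[measureRZ] _
  rw [LinearIsometryEquiv.apply_symm_apply]
  exact f.memLp.coeFn_toLp

theorem besselPotential_injective (s : ℝ) : Function.Injective (besselPotential s) := by
  rw [← LinearMap.ker_eq_bot, LinearMap.ker_eq_bot']
  intro f hf
  have h := fourierRT_besselPotential f
  rw [hf, map_zero] at h
  apply Subtype.ext
  change f.toL2 = 0
  rw [← fourierRT.map_eq_zero_iff, Lp.eq_zero_iff_ae_eq_zero]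
  filter_upwards [h, Lp.coeFn_zero ℂ 2 measureRZ] with p h1 h2
  rw [h2] at h1
  simpa [(besselWeight_pos s p).ne'] using h1.symm

/-- The Sobolev norm `‖f‖ = ‖ℱ⁻¹ [(1 + ξ² + j²)^{s/2} ℱ f]‖_{L²}`. -/
instance (s : ℝ) : NormedAddCommGroup (Sobolev s) :=
  NormedAddCommGroup.induced (Sobolev s) L2RT (besselPotential s) (besselPotential_injective s)

instance (s : ℝ) : NormedSpace ℂ (Sobolev s) :=
  NormedSpace.induced ℂ (Sobolev s) L2RT (besselPotential s)

theorem Sobolev.norm_eq {s : ℝ} (f : Sobolev s) : ‖f‖ = ‖besselPotential s f‖ := rfl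

end

end SobolevQ

namespace SobolevQ

noncomputable section

open MeasureTheory Set Filter
open scoped ENNReal Real SchwartzMap FourierTransform

/-! Every factor of `Q_a` respects the expansion in the characters `e^{ijθ}`. On the `j`-th mode,
`Q_a` passes to the logarithmic variable `x = e^t`, applies the one-dimensional multiplier `M_a(·,
j)`, and returns to `x > 0` with extension by zero (`mode_opQ`). The Sobolev norm is the sum over
`j` of one-dimensional norms, so it suffices to bound each mode with a constant independent of `j`.
The weight `(1 + ξ² + j²)^s` is comparable to `(1 + j²)^s + |ξ|^{2s}`. The first term is handled by
boundedness on `L²`, and the second is a multiple of the Gagliardo seminorm (`gagliardo_eq`).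

In logarithmic coordinates the Gagliardo seminorm on the half-line is a superposition over `v` of
the norms of `h - e^{-v/2} h(· + v)` in `L²(e^{-2st} dt)`. A multiplier commutes with translations,
so its boundedness on that weighted space gives its boundedness for the seminorm
(`logGagliardo_map_le`). Extension by zero adds the Hardy term `∫ x^{-2s} |g|² dx`
(`gagliardo_ofLog`), which is controlled by the seminorm because `s < 1/2`
(`exists_logNorm_le_logGagliardo`).

For the weighted bound, conjugation by `e^{-st}` shifts the frequency to `ξ - is/(2π)`. A multiplier
holomorphic and bounded on the strip between the two lines is therefore bounded on the weighted
space (`logNorm_multiplierR_le`). Up to the factor `e^{a/4}` the symbol is `1 / (1 + e^w)` with `|Im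
w| ≤ 2|a|s` on that strip. The condition `2|a|s < π` keeps it away from the poles, and `j` only
moves `Re w`, so the bound is uniform in `j`. -/

/-! ### Fourier transform, translations and multipliers on the line -/

/-- The space `L²(ℝ)`. -/
abbrev L2R : Type := Lp ℂ 2 (volume : Measure ℝ)

/-- The Fourier transform on `L²(ℝ)`, with kernel `e^{-2πixξ}`. -/
abbrev fourierL2 : L2R ≃ₗᵢ[ℂ] L2R := Lp.fourierTransformₗᵢ ℝ ℂ

/-- Both transforms satisfy `∫ ψ ĝ = ∫ ψ̂ g`: one as a tempered distribution, the other by Fubini.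
Hence they agree against all smooth compactly supported test functions. -/
theorem coeFn_fourierL2_of_integrable (g : L2R) (hg : Integrable g) :
    fourierL2 g =ᵐ[volume] 𝓕 (g : ℝ → ℂ) := by
  have hcont : Continuous (𝓕 (g : ℝ → ℂ)) :=
    VectorFourier.fourierIntegral_continuous Real.continuous_fourierChar
      (innerSL ℝ).continuous₂ hg
  refine ae_eq_of_integral_contDiff_smul_eq
    ((Lp.memLp (fourierL2 g)).locallyIntegrable (by norm_num)) hcont.locallyIntegrable ?_
  intro φ hφ hφc
  set ψ : 𝓢(ℝ, ℂ) := HasCompactSupport.toSchwartzMap (f := fun x => (φ x : ℂ))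
    (hφc.comp_left (g := fun x : ℝ => (x : ℂ)) (by simp)) (Complex.ofRealCLM.contDiff.comp hφ)
    with hψ
  have hψx : ∀ x, ψ x = φ x := fun x => rfl
  have h1 := congrArg (fun T => T ψ) (Lp.fourier_toTemperedDistribution_eq g)
  simp only [TemperedDistribution.fourier_apply, Lp.toTemperedDistribution_apply] at h1
  have h2 := VectorFourier.integral_fourierIntegral_smul_eq_flip (μ := volume) (ν := volume)
    (L := innerₗ ℝ) (f := ψ) (g := (g : ℝ → ℂ)) Real.continuous_fourierChar
      (innerSL ℝ).continuous₂ (ψ.integrable) hg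
  have h3 : ∀ x, φ x • (fourierL2 g) x = ψ x • (fourierL2 g) x := fun x => by
    rw [hψx]; simp
  have h4 : ∀ x, φ x • (𝓕 (g : ℝ → ℂ)) x = ψ x • (𝓕 (g : ℝ → ℂ)) x := fun x => by
    rw [hψx]; simp
  simp only [h3, h4]
  refine h1.symm.trans (Eq.trans ?_ (h2.trans ?_))
  · rw [SchwartzMap.fourier_coe]; rfl
  · rw [flip_innerₗ]; rfl

theorem measurable_coeFn {α : Type*} [MeasurableSpace α] {μ : Measure α} (g : Lp ℂ 2 μ) :
    Measurable (g : α → ℂ) := (Lp.stronglyMeasurable g).measurable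

theorem isL2Weight_translate (v : ℝ) :
    IsL2Weight (volume : Measure ℝ) volume (fun x => x + v) (fun _ => 1) where
  meas_map := by fun_prop
  meas_weight := by fun_prop
  lintegral_eq F hF := by
    simpa using lintegral_add_right_eq_self F v

/-- The translation `g ↦ g(· + v)` on `L²(ℝ)`. -/
def translate (v : ℝ) : L2R →ₗᵢ[ℂ] L2R := (isL2Weight_translate v).isometry

theorem coeFn_translate (v : ℝ) (g : L2R) :
    translate v g =ᵐ[volume] fun x => g (x + v) := by
  filter_upwards [(isL2Weight_translate v).coeFn_isometry g] with x hx
  rw [translate, hx, one_mul]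

/-- The character `ξ ↦ e^{2πivξ}`. -/
def character (v ξ : ℝ) : ℂ := Real.fourierChar (v * ξ)

theorem norm_character (v ξ : ℝ) : ‖character v ξ‖ = 1 := Circle.norm_coe _

theorem measurable_character (v : ℝ) : Measurable (character v) := by
  have : Continuous (character v) := by
    unfold character
    exact continuous_subtype_val.comp (Real.continuous_fourierChar.comp (by fun_prop))
  exact this.measurable

theorem isL2Weight_modulate (v : ℝ) :
    IsL2Weight (volume : Measure ℝ) volume id (character v) where
  meas_map := measurable_id
  meas_weight := measurable_character v
  lintegral_eq F hF := by
    refine lintegral_congr fun ξ => ?_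
    rw [← ofReal_norm, norm_character]
    simp

/-- Both sides are continuous in `g`, so density reduces the identity to Schwartz functions, where
the Fourier integral is available. -/
theorem fourierL2_translate (v : ℝ) (g : L2R) :
    fourierL2 (translate v g) = (isL2Weight_modulate v).isometry (fourierL2 g) := by
  refine DenseRange.induction_on (p := fun g : L2R => fourierL2 (translate v g) =
    (isL2Weight_modulate v).isometry (fourierL2 g))
    (SchwartzMap.denseRange_toLpCLM (p := 2) (E := ℝ) (F := ℂ) (μ := volume)
      ENNReal.ofNat_ne_top) g ?_ ?_
  · apply isClosed_eq
    · exact fourierL2.continuous.comp (translate v).continuous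
    · exact (isL2Weight_modulate v).isometry.continuous.comp fourierL2.continuous
  · intro φ
    change fourierL2 (translate v (φ.toLp 2)) =
      (isL2Weight_modulate v).isometry (fourierL2 (φ.toLp 2))
    have h0 := φ.coeFn_toLp 2 (volume : Measure ℝ)
    have hi : Integrable (φ.toLp 2 (volume : Measure ℝ)) := φ.integrable.congr h0.symm
    have h1 : translate v (φ.toLp 2) =ᵐ[volume] fun x => φ (x + v) :=
      (coeFn_translate v _).trans
        ((measurePreserving_add_right volume v).quasiMeasurePreserving.ae_eq h0)
    have hi' : Integrable (translate v (φ.toLp 2)) :=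
      (φ.integrable.comp_add_right v).congr h1.symm
    have h2 : 𝓕 (translate v (φ.toLp 2) : ℝ → ℂ) = fun ξ => character v ξ * 𝓕 (φ : ℝ → ℂ) ξ := by
      funext ξ
      rw [Real.fourier_congr_ae h1]
      have := congrFun (VectorFourier.fourierIntegral_comp_add_right Real.fourierChar volume
        (innerₗ ℝ) (φ : ℝ → ℂ) v) ξ
      refine this.trans ?_
      simp only [innerₗ_apply_apply, RCLike.inner_apply, conj_trivial, Circle.smul_def,
        smul_eq_mul, mul_comm ξ v]
      rfl
    have h3 : 𝓕 (φ.toLp 2 (volume : Measure ℝ) : ℝ → ℂ) = 𝓕 (φ : ℝ → ℂ) := by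
      funext ξ
      rw [Real.fourier_congr_ae h0]
    refine Lp.ext ?_
    filter_upwards [coeFn_fourierL2_of_integrable _ hi, coeFn_fourierL2_of_integrable _ hi',
      (isL2Weight_modulate v).coeFn_isometry (fourierL2 (φ.toLp 2))] with ξ e1 e2 e3
    rw [e2, e3, id, e1, h2, h3]

/-- Multiplication by the bounded function `m` on `L²(ℝ)`. -/
def mulR (m : ℝ → ℂ) (hm : MemLp m ∞ volume) : L2R →L[ℂ] L2R :=
  (ContinuousLinearMap.mul ℂ ℂ).holderL volume ∞ 2 2 hm.toLp

theorem coeFn_mulR (m : ℝ → ℂ) (hm : MemLp m ∞ volume) (h : L2R) :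
    mulR m hm h =ᵐ[volume] fun ξ => m ξ * h ξ := by
  filter_upwards [(ContinuousLinearMap.mul ℂ ℂ).coeFn_holder (r := 2) hm.toLp h,
    hm.coeFn_toLp] with p h1 h2
  refine Eq.trans h1 ?_
  rw [h2]
  rfl

theorem norm_mulR_le (m : ℝ → ℂ) (hm : MemLp m ∞ volume) {B : ℝ} (hB : ∀ ξ, ‖m ξ‖ ≤ B) (h : L2R) :
    ‖mulR m hm h‖ ≤ B * ‖h‖ := by
  refine Lp.norm_le_mul_norm_of_ae_le_mul ?_
  filter_upwards [coeFn_mulR m hm h] with ξ e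
  rw [e, norm_mul]
  exact mul_le_mul_of_nonneg_right (hB ξ) (norm_nonneg _)

/-- The Fourier multiplier `h ↦ 𝓕⁻¹ (m · 𝓕 h)` on `L²(ℝ)`. -/
def multiplierR (m : ℝ → ℂ) (hm : MemLp m ∞ volume) : L2R →L[ℂ] L2R :=
  (fourierL2.symm : L2R →L[ℂ] L2R) ∘L mulR m hm ∘L (fourierL2 : L2R →L[ℂ] L2R)

theorem fourierL2_multiplierR_eq (m : ℝ → ℂ) (hm : MemLp m ∞ volume) (h : L2R) :
    fourierL2 (multiplierR m hm h) = mulR m hm (fourierL2 h) := by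
  simp [multiplierR]

theorem fourierL2_multiplierR (m : ℝ → ℂ) (hm : MemLp m ∞ volume) (h : L2R) :
    fourierL2 (multiplierR m hm h) =ᵐ[volume] fun ξ => m ξ * fourierL2 h ξ := by
  rw [fourierL2_multiplierR_eq]
  exact coeFn_mulR m hm _

theorem norm_multiplierR_le (m : ℝ → ℂ) (hm : MemLp m ∞ volume) {B : ℝ} (hB : ∀ ξ, ‖m ξ‖ ≤ B)
    (h : L2R) : ‖multiplierR m hm h‖ ≤ B * ‖h‖ := by
  rw [← fourierL2.norm_map (multiplierR m hm h), fourierL2_multiplierR_eq, ← fourierL2.norm_map h]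
  exact norm_mulR_le m hm hB _

/-- On the Fourier side both operators are multiplications by functions, which commute. -/
theorem multiplierR_translate (m : ℝ → ℂ) (hm : MemLp m ∞ volume) (v : ℝ) (h : L2R) :
    multiplierR m hm (translate v h) = translate v (multiplierR m hm h) := by
  apply fourierL2.injective
  refine Lp.ext ?_
  rw [fourierL2_translate]
  have h1 := fourierL2_translate v h
  filter_upwards [fourierL2_multiplierR m hm (translate v h), fourierL2_multiplierR m hm h,
    (isL2Weight_modulate v).coeFn_isometry (fourierL2 (multiplierR m hm h)),
    (isL2Weight_modulate v).coeFn_isometry (fourierL2 h)] with ξ e1 e2 e3 e4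
  rw [e1, e3, h1, e4, id, e2]
  ring

/-! ### The Gagliardo seminorm and its Fourier form -/

/-- The weight `|v|^{-1-2s}`. -/
def gagliardoWeight (s v : ℝ) : ℝ≥0∞ := ENNReal.ofReal (|v| ^ (-1 - 2 * s))

theorem measurable_gagliardoWeight (s : ℝ) : Measurable (gagliardoWeight s) := by
  unfold gagliardoWeight; fun_prop

/-- The squared Gagliardo seminorm `∫∫ |g(x + v) - g(x)|² |v|^{-1-2s} dx dv`. -/
def gagliardo (s : ℝ) (g : ℝ → ℂ) : ℝ≥0∞ :=
  ∫⁻ v, gagliardoWeight s v * ∫⁻ x, ‖g (x + v) - g x‖ₑ ^ 2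

/-- The function `η ↦ ∫ |e^{2πivη} - 1|² |v|^{-1-2s} dv`. -/
def gagliardoSymbol (s η : ℝ) : ℝ≥0∞ :=
  ∫⁻ v, gagliardoWeight s v * ‖character v η - 1‖ₑ ^ 2

theorem character_eq_exp (v ξ : ℝ) : character v ξ = Complex.exp (Complex.I * (2 * π * (v * ξ) : ℝ)) := by
  rw [character, Real.fourierChar_apply]
  congr 1
  push_cast
  ring

theorem measurable_character_uncurry : Measurable fun p : ℝ × ℝ => character p.1 p.2 := by
  simp only [character_eq_exp]
  fun_prop

theorem measurable_character_left (ξ : ℝ) : Measurable fun v => character v ξ := by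
  simp only [character_eq_exp]
  fun_prop

/-- Scaling `v ↦ ηv`: the weight contributes `|η|^{1+2s}` and the measure `|η|⁻¹`. -/
theorem gagliardoSymbol_eq {s : ℝ} (η : ℝ) (hη : η ≠ 0) :
    gagliardoSymbol s η = ENNReal.ofReal (|η| ^ (2 * s)) * gagliardoSymbol s 1 := by
  have hη' : 0 < |η| := abs_pos.2 hη
  have hm : Measurable fun v => gagliardoWeight s v * ‖character v 1 - 1‖ₑ ^ 2 :=
    (measurable_gagliardoWeight s).mul (((measurable_character_left 1).sub_const 1).enorm.pow_const 2)
  have h1 : ∀ v, gagliardoWeight s v * ‖character v η - 1‖ₑ ^ 2 =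
      ENNReal.ofReal (|η| ^ (1 + 2 * s)) *
        (gagliardoWeight s (η * v) * ‖character (η * v) 1 - 1‖ₑ ^ 2) := by
    intro v
    rw [← mul_assoc, gagliardoWeight, gagliardoWeight, ← ENNReal.ofReal_mul (by positivity),
      abs_mul, Real.mul_rpow (abs_nonneg _) (abs_nonneg _), ← mul_assoc, ← Real.rpow_add hη']
    have h2 : 1 + 2 * s + (-1 - 2 * s) = 0 := by ring
    have h3 : character v η = character (η * v) 1 := by
      unfold character; congr 2; ring
    rw [h2, h3]
    simp
  have hm' : Measurable fun v => gagliardoWeight s (η * v) * ‖character (η * v) 1 - 1‖ₑ ^ 2 :=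
    hm.comp (measurable_const_mul η)
  rw [gagliardoSymbol, lintegral_congr h1, lintegral_const_mul _ hm']
  have h2 : ∫⁻ v, (gagliardoWeight s (η * v) * ‖character (η * v) 1 - 1‖ₑ ^ 2)
      = ENNReal.ofReal |η⁻¹| * gagliardoSymbol s 1 := by
    rw [← lintegral_map hm (measurable_const_mul η), Real.map_volume_mul_left hη,
      lintegral_smul_measure]
    rfl
  rw [h2, ← mul_assoc, ← ENNReal.ofReal_mul (by positivity), abs_inv, ← Real.rpow_neg_one,
    ← Real.rpow_add hη']
  congr 3
  ring

/-- The integrand has no zero in `(0, 1)`, since `e^{2πiv} = 1` only at integers. With finiteness,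
this allows the constant to be cancelled from seminorm inequalities. -/
theorem gagliardoSymbol_one_ne_zero (s : ℝ) : gagliardoSymbol s 1 ≠ 0 := by
  have hm : Measurable fun v => gagliardoWeight s v * ‖character v 1 - 1‖ₑ ^ 2 :=
    (measurable_gagliardoWeight s).mul (((measurable_character_left 1).sub_const 1).enorm.pow_const 2)
  rw [gagliardoSymbol, Ne, lintegral_eq_zero_iff hm]
  intro h
  have h1 : (volume : Measure ℝ) (Ioo 0 1) ≤ volume {v : ℝ | ¬ (gagliardoWeight s v * ‖character v 1 - 1‖ₑ ^ 2 = (0 : ℝ → ℝ≥0∞) v)} := by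
    refine measure_mono fun v hv hz => ?_
    rw [Pi.zero_apply, mul_eq_zero] at hz
    rcases hz with hz | hz
    · rw [gagliardoWeight, ENNReal.ofReal_eq_zero] at hz
      exact absurd hz (not_le.2 (Real.rpow_pos_of_pos (abs_pos.2 hv.1.ne') _))
    · have hz' : character v 1 = 1 := by simpa [sub_eq_zero] using hz
      rw [character_eq_exp, Complex.exp_eq_one_iff] at hz'
      obtain ⟨n, hn⟩ := hz'
      have h2 : (v : ℂ) = n := by
        have hne : (2 * π * Complex.I : ℂ) ≠ 0 := Complex.two_pi_I_ne_zero
        apply mul_right_cancel₀ hne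
        rw [← hn]
        push_cast
        ring
      have h3 : v = n := by exact_mod_cast h2
      have h4 := hv.1
      have h5 := hv.2
      rw [h3] at h4 h5
      have h6 : 0 < n := by exact_mod_cast h4
      have h7 : n < 1 := by exact_mod_cast h5
      omega
  rw [show volume {v : ℝ | ¬ (gagliardoWeight s v * ‖character v 1 - 1‖ₑ ^ 2 = (0 : ℝ → ℝ≥0∞) v)} = 0 from h] at h1
  simp at h1

theorem enorm_character_sub_one_le (v : ℝ) : ‖character v 1 - 1‖ₑ ≤ ENNReal.ofReal (2 * π * |v|) := by
  rw [← ofReal_norm, character_eq_exp]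
  refine ENNReal.ofReal_le_ofReal ((Real.norm_exp_I_mul_ofReal_sub_one_le).trans ?_)
  rw [mul_one, Real.norm_eq_abs, abs_mul, abs_of_pos Real.two_pi_pos]

theorem lintegral_even_le {f : ℝ → ℝ≥0∞} (hf : Measurable f) (heven : ∀ v, f (-v) = f v) :
    ∫⁻ v, f v ≤ 2 * ∫⁻ v in Ioi 0, f v := by
  have hm : Measurable ((Ioi (0 : ℝ)).indicator f) := hf.indicator measurableSet_Ioi
  calc ∫⁻ v, f v ≤ ∫⁻ v, ((Ioi (0 : ℝ)).indicator f v + (Ioi (0 : ℝ)).indicator f (-v)) := by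
        refine lintegral_mono_ae ?_
        filter_upwards [Measure.ae_ne volume (0 : ℝ)] with v hv
        rcases lt_or_gt_of_ne hv with h | h
        · rw [indicator_of_mem (show -v ∈ Ioi (0 : ℝ) from neg_pos.2 h), heven]
          exact le_add_self
        · rw [indicator_of_mem (show v ∈ Ioi (0 : ℝ) from h)]
          exact le_self_add
    _ = _ := by
        rw [lintegral_add_left hm, lintegral_neg_eq_self, lintegral_indicator measurableSet_Ioi,
          two_mul]

theorem lintegral_Ioi_rpow {p c : ℝ} (hp : p < -1) (hc : 0 < c) :
    ∫⁻ v in Ioi c, ENNReal.ofReal (v ^ p) = ENNReal.ofReal (-c ^ (p + 1) / (p + 1)) := by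
  rw [← ofReal_integral_eq_lintegral_ofReal (integrableOn_Ioi_rpow_of_lt hp hc),
    integral_Ioi_rpow_of_lt hp hc]
  filter_upwards [ae_restrict_mem measurableSet_Ioi] with v hv
  exact Real.rpow_nonneg (hc.trans hv).le _

/-- Near `0` the integrand is at most a constant times `|v|^{1-2s}`, integrable for `s < 1`; at
infinity it is at most `4|v|^{-1-2s}`, integrable for `s > 0`. -/
theorem gagliardoSymbol_one_ne_top {s : ℝ} (hs₀ : 0 < s) (hs₁ : s < 1) :
    gagliardoSymbol s 1 ≠ ∞ := by
  have hm : Measurable fun v => gagliardoWeight s v * ‖character v 1 - 1‖ₑ ^ 2 :=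
    (measurable_gagliardoWeight s).mul (((measurable_character_left 1).sub_const 1).enorm.pow_const 2)
  refine ne_top_of_le_ne_top ?_ (lintegral_even_le hm fun v => ?_)
  · refine ENNReal.mul_ne_top (by norm_num) ?_
    rw [← Ioc_union_Ioi_eq_Ioi zero_le_one]
    refine ne_top_of_le_ne_top ?_ (lintegral_union_le _ _ _)
    refine ENNReal.add_ne_top.2 ⟨?_, ?_⟩
    · have hi : IntegrableOn (fun v : ℝ => (2 * π) ^ 2 * v ^ (1 - 2 * s)) (Ioc 0 1) := by
        rw [← intervalIntegrable_iff_integrableOn_Ioc_of_le zero_le_one]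
        exact (intervalIntegral.intervalIntegrable_rpow' (by linarith)).const_mul _
      refine ne_top_of_le_ne_top hi.lintegral_lt_top.ne (setLIntegral_mono' measurableSet_Ioc ?_)
      intro v hv
      have h1 : ‖character v 1 - 1‖ₑ ^ 2 ≤ ENNReal.ofReal ((2 * π * |v|) ^ 2) := by
        rw [ENNReal.ofReal_pow (by positivity)]
        exact pow_le_pow_left' (enorm_character_sub_one_le v) 2
      refine (mul_le_mul_right h1 _).trans ?_
      rw [gagliardoWeight, ← ENNReal.ofReal_mul (by positivity), abs_of_pos hv.1]
      refine ENNReal.ofReal_le_ofReal (le_of_eq ?_)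
      rw [mul_pow, mul_left_comm, ← Real.rpow_natCast v 2, ← Real.rpow_add hv.1]
      congr 2
      push_cast
      ring
    · have h1 : ∀ v, ‖character v 1 - 1‖ₑ ^ 2 ≤ 4 := by
        intro v
        have h2 : ‖character v 1 - 1‖ₑ ≤ 2 := by
          refine (enorm_sub_le).trans ?_
          rw [← ofReal_norm, norm_character]
          norm_num
        exact (pow_le_pow_left' h2 2).trans (by norm_num)
      refine ne_top_of_le_ne_top (b := 4 * ∫⁻ v in Ioi (1 : ℝ), ENNReal.ofReal (v ^ (-1 - 2 * s)))
        ?_ ?_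
      · rw [lintegral_Ioi_rpow (by linarith) one_pos]
        exact ENNReal.mul_ne_top (by norm_num) ENNReal.ofReal_ne_top
      · rw [← lintegral_const_mul _ (by fun_prop)]
        refine setLIntegral_mono' measurableSet_Ioi fun v hv => ?_
        rw [gagliardoWeight, abs_of_pos (one_pos.trans hv), mul_comm]
        exact mul_le_mul_left (h1 v) _
  · have h1 : character (-v) 1 - 1 = - ((character v 1 - 1) / character v 1) := by
      have h2 : character v 1 ≠ 0 := by rw [← norm_ne_zero_iff, norm_character]; simp
      have h3 : character (-v) 1 * character v 1 = 1 := by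
        rw [character, character, ← Circle.coe_mul, ← AddChar.map_add_eq_mul]
        simp
      field_simp
      linear_combination h3
    have h5 : ‖character (-v) 1 - 1‖ = ‖character v 1 - 1‖ := by
      rw [h1, norm_neg, norm_div, norm_character, div_one]
    rw [gagliardoWeight, gagliardoWeight, abs_neg, ← ofReal_norm (character (-v) 1 - 1), h5,
      ofReal_norm]

/-- Plancherel in `x` for each fixed `v`, then Tonelli: the integral over `v` is `gagliardoSymbol s
η`, evaluated by scaling off the null set `η = 0`. -/
theorem gagliardo_eq (s : ℝ) (g : L2R) :
    gagliardo s g = gagliardoSymbol s 1 *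
      ∫⁻ η, ENNReal.ofReal (|η| ^ (2 * s)) * ‖fourierL2 g η‖ₑ ^ 2 := by
  have h1 : ∀ v, ∫⁻ x, ‖g (x + v) - g x‖ₑ ^ 2 =
      ∫⁻ η, ‖character v η - 1‖ₑ ^ 2 * ‖fourierL2 g η‖ₑ ^ 2 := by
    intro v
    have e1 : ∫⁻ x, ‖g (x + v) - g x‖ₑ ^ 2 = ‖translate v g - g‖ₑ ^ 2 := by
      rw [← lintegral_enorm_sq]
      refine lintegral_congr_ae ?_
      filter_upwards [coeFn_translate v g, Lp.coeFn_sub (translate v g) g] with x h2 h3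
      rw [h3, Pi.sub_apply, h2]
    have e2 : ‖translate v g - g‖ₑ = ‖fourierL2 (translate v g - g)‖ₑ := by
      rw [← ofReal_norm, ← ofReal_norm, LinearIsometryEquiv.norm_map]
    rw [e1, e2, ← lintegral_enorm_sq, map_sub, fourierL2_translate]
    refine lintegral_congr_ae ?_
    filter_upwards [(isL2Weight_modulate v).coeFn_isometry (fourierL2 g),
      Lp.coeFn_sub ((isL2Weight_modulate v).isometry (fourierL2 g)) (fourierL2 g)] with x h2 h3
    rw [h3, Pi.sub_apply, h2, id, ← mul_pow, ← enorm_mul, sub_mul, one_mul]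
  have hmc : Measurable (Function.uncurry fun v η : ℝ =>
      gagliardoWeight s v * (‖character v η - 1‖ₑ ^ 2 * ‖fourierL2 g η‖ₑ ^ 2)) := by
    have h1 := measurable_coeFn (fourierL2 g)
    have h2 := measurable_gagliardoWeight s
    have h3 := measurable_character_uncurry
    unfold Function.uncurry
    exact (h2.comp measurable_fst).mul (((h3.sub_const 1).enorm.pow_const 2).mul
      ((h1.comp measurable_snd).enorm.pow_const 2))
  calc gagliardo s g
      = ∫⁻ v, ∫⁻ η, gagliardoWeight s v * (‖character v η - 1‖ₑ ^ 2 * ‖fourierL2 g η‖ₑ ^ 2) := by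
        refine lintegral_congr fun v => ?_
        rw [h1, lintegral_const_mul]
        exact (((measurable_character v).sub_const 1).enorm.pow_const 2).mul
          ((measurable_coeFn (fourierL2 g)).enorm.pow_const 2)
    _ = ∫⁻ η, ∫⁻ v, gagliardoWeight s v * (‖character v η - 1‖ₑ ^ 2 * ‖fourierL2 g η‖ₑ ^ 2) :=
        lintegral_lintegral_swap hmc.aemeasurable
    _ = ∫⁻ η, gagliardoSymbol s 1 * (ENNReal.ofReal (|η| ^ (2 * s)) * ‖fourierL2 g η‖ₑ ^ 2) := by
        refine lintegral_congr_ae ?_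
        filter_upwards [Measure.ae_ne volume (0 : ℝ)] with η hη
        simp only [← mul_assoc]
        rw [lintegral_mul_const, ← gagliardoSymbol, gagliardoSymbol_eq η hη,
          mul_comm (ENNReal.ofReal _)]
        exact (measurable_gagliardoWeight s).mul
          (((measurable_character_left η).sub_const 1).enorm.pow_const 2)
    _ = _ := by
        rw [lintegral_const_mul]
        exact (by fun_prop : Measurable fun η : ℝ => ENNReal.ofReal (|η| ^ (2 * s))).mul
          ((measurable_coeFn (fourierL2 g)).enorm.pow_const 2)

/-! ### Logarithmic coordinates on the half-line -/

theorem lintegral_exp_mul_comp_exp (F : ℝ → ℝ≥0∞) :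
    ∫⁻ t, ENNReal.ofReal (Real.exp t) * F (Real.exp t) = ∫⁻ x in Ioi 0, F x := by
  have h := lintegral_image_eq_lintegral_abs_deriv_mul (s := univ) (f := Real.exp)
    (f' := Real.exp) MeasurableSet.univ
    (fun x _ => (Real.hasDerivAt_exp x).hasDerivWithinAt) Real.exp_injective.injOn F
  rw [image_univ, Real.range_exp, setLIntegral_univ] at h
  rw [h]
  simp only [abs_of_pos (Real.exp_pos _)]

theorem enorm_ofReal_exp_sq (x : ℝ) :
    ‖(Real.exp x : ℂ)‖ₑ ^ 2 = ENNReal.ofReal (Real.exp (2 * x)) := by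
  rw [← ofReal_norm, ← ENNReal.ofReal_pow (norm_nonneg _), Complex.norm_real,
    Real.norm_of_nonneg (Real.exp_pos _).le, ← Real.exp_nat_mul]
  norm_cast

theorem isL2Weight_exp :
    IsL2Weight ((volume : Measure ℝ).restrict (Ioi 0)) volume Real.exp
      (fun t => (Real.exp (t / 2) : ℂ)) where
  meas_map := by fun_prop
  meas_weight := by fun_prop
  lintegral_eq F hF := by
    rw [← lintegral_exp_mul_comp_exp F]
    refine lintegral_congr fun t => ?_
    rw [enorm_ofReal_exp_sq, mul_div_cancel₀ t two_ne_zero, mul_comm]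

theorem isL2Weight_log :
    IsL2Weight (volume : Measure ℝ) volume Real.log
      ((Ioi 0).indicator fun x => (Real.exp (-(Real.log x / 2)) : ℂ)) where
  meas_map := by fun_prop
  meas_weight := (by fun_prop : Measurable fun x => (Real.exp (-(Real.log x / 2)) : ℂ)).indicator
    measurableSet_Ioi
  lintegral_eq F hF := by
    have h : ∀ x, F (Real.log x) *
        ‖(Ioi (0 : ℝ)).indicator (fun x => (Real.exp (-(Real.log x / 2)) : ℂ)) x‖ₑ ^ 2 =
        (Ioi (0 : ℝ)).indicator
          (fun x => F (Real.log x) * ENNReal.ofReal (Real.exp (-Real.log x))) x := by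
      intro x
      by_cases hx : x ∈ Ioi (0 : ℝ)
      · rw [indicator_of_mem hx, indicator_of_mem hx, enorm_ofReal_exp_sq]
        congr 3
        ring
      · rw [indicator_of_notMem hx, indicator_of_notMem hx]
        simp
    rw [lintegral_congr h, lintegral_indicator measurableSet_Ioi, ← lintegral_exp_mul_comp_exp]
    refine lintegral_congr fun t => ?_
    rw [Real.log_exp, mul_left_comm, ← ENNReal.ofReal_mul (Real.exp_pos _).le, ← Real.exp_add]
    simp

/-- The map `g ↦ (t ↦ e^{t/2} g(e^t))` on `L²(ℝ)`. -/
def toLog : L2R →L[ℂ] L2R :=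
  isL2Weight_exp.isometry.toContinuousLinearMap ∘L
    LpToLpRestrictCLM ℝ ℂ ℂ volume 2 (Ioi 0)

theorem coeFn_toLog (g : L2R) :
    toLog g =ᵐ[volume] fun t => (Real.exp (t / 2) : ℂ) * g (Real.exp t) := by
  have h := isL2Weight_exp.ae_congr (LpToLpRestrictCLM_coeFn ℂ (Ioi (0 : ℝ)) g)
  exact (isL2Weight_exp.coeFn_isometry _).trans h

/-- The isometry `h ↦ (x ↦ x^{-1/2} h(log x))` of `L²(ℝ)`, extended by zero to `x ≤ 0`. -/
def ofLog : L2R →ₗᵢ[ℂ] L2R := isL2Weight_log.isometry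

theorem coeFn_ofLog (h : L2R) :
    ofLog h =ᵐ[volume]
      (Ioi 0).indicator fun x => (Real.exp (-(Real.log x / 2)) : ℂ) * h (Real.log x) := by
  filter_upwards [isL2Weight_log.coeFn_isometry h] with x hx
  rw [ofLog, hx]
  by_cases h0 : x ∈ Ioi (0 : ℝ)
  · rw [indicator_of_mem h0, indicator_of_mem h0]
  · rw [indicator_of_notMem h0, indicator_of_notMem h0, zero_mul]

/-- The squared norm `∫ e^{-2st} |h(t)|² dt`. -/
def logNorm (s : ℝ) (h : ℝ → ℂ) : ℝ≥0∞ :=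
  ∫⁻ t, ENNReal.ofReal (Real.exp (-(2 * s * t))) * ‖h t‖ₑ ^ 2

theorem logNorm_congr {s : ℝ} {h k : ℝ → ℂ} (hk : h =ᵐ[volume] k) : logNorm s h = logNorm s k := by
  refine lintegral_congr_ae ?_
  filter_upwards [hk] with t ht
  rw [ht]

/-- The increment `t ↦ h(t) - e^{-v/2} h(t + v)`. -/
def logIncr (h : ℝ → ℂ) (v : ℝ) : ℝ → ℂ := fun t => h t - (Real.exp (-(v / 2)) : ℂ) * h (t + v)

/-- The weight `e^v |1 - e^v|^{-1-2s}`. -/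
def logWeight (s v : ℝ) : ℝ≥0∞ := ENNReal.ofReal (Real.exp v) * gagliardoWeight s (1 - Real.exp v)

theorem measurable_logWeight (s : ℝ) : Measurable (logWeight s) := by
  have := measurable_gagliardoWeight s
  unfold logWeight
  fun_prop

/-- The squared Gagliardo seminorm on `(0, ∞)` in logarithmic coordinates. -/
def logGagliardo (s : ℝ) (h : ℝ → ℂ) : ℝ≥0∞ :=
  ∫⁻ v, logWeight s v * logNorm s (logIncr h v)

theorem logIncr_congr {h k : ℝ → ℂ} (hk : h =ᵐ[volume] k) (v : ℝ) :
    logIncr h v =ᵐ[volume] logIncr k v := by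
  filter_upwards [hk, (measurePreserving_add_right volume v).quasiMeasurePreserving.ae_eq hk]
    with t h1 h2
  simp only [Function.comp_apply] at h2
  rw [logIncr, logIncr, h1, h2]

theorem logGagliardo_congr {s : ℝ} {h k : ℝ → ℂ} (hk : h =ᵐ[volume] k) :
    logGagliardo s h = logGagliardo s k :=
  lintegral_congr fun v => by rw [logNorm_congr (logIncr_congr hk v)]

theorem gagliardo_congr {s : ℝ} {h k : ℝ → ℂ} (hk : h =ᵐ[volume] k) :
    gagliardo s h = gagliardo s k := by
  refine lintegral_congr fun v => ?_
  congr 1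
  refine lintegral_congr_ae ?_
  filter_upwards [hk, (measurePreserving_add_right volume v).quasiMeasurePreserving.ae_eq hk]
    with t h1 h2
  simp only [Function.comp_apply] at h2
  rw [h1, h2]

theorem gagliardoWeight_neg (s v : ℝ) : gagliardoWeight s (-v) = gagliardoWeight s v := by
  rw [gagliardoWeight, gagliardoWeight, abs_neg]

theorem gagliardoWeight_mul (s c v : ℝ) :
    gagliardoWeight s (c * v) = gagliardoWeight s c * gagliardoWeight s v := by
  rw [gagliardoWeight, gagliardoWeight, gagliardoWeight, abs_mul,
    Real.mul_rpow (abs_nonneg _) (abs_nonneg _), ENNReal.ofReal_mul (by positivity)]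

theorem gagliardoWeight_exp (s t : ℝ) :
    gagliardoWeight s (Real.exp t) = ENNReal.ofReal (Real.exp (t * (-1 - 2 * s))) := by
  rw [gagliardoWeight, abs_of_pos (Real.exp_pos t), Real.exp_mul]

/-- The integrand `|g(y) - g(x)|² |y - x|^{-1-2s}` of the Gagliardo seminorm. -/
def gagliardoKernel (s : ℝ) (g : ℝ → ℂ) (x y : ℝ) : ℝ≥0∞ :=
  gagliardoWeight s (y - x) * ‖g y - g x‖ₑ ^ 2

theorem gagliardoKernel_comm (s : ℝ) (g : ℝ → ℂ) (x y : ℝ) :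
    gagliardoKernel s g x y = gagliardoKernel s g y x := by
  rw [gagliardoKernel, gagliardoKernel, ← neg_sub x y, gagliardoWeight_neg, enorm_sub_rev]

theorem measurable_gagliardoKernel (s : ℝ) {g : ℝ → ℂ} (hg : Measurable g) :
    Measurable (Function.uncurry (gagliardoKernel s g)) := by
  have := measurable_gagliardoWeight s
  unfold gagliardoKernel Function.uncurry
  fun_prop

theorem gagliardo_eq_lintegral_kernel (s : ℝ) {g : ℝ → ℂ} (hg : Measurable g) :
    gagliardo s g = ∫⁻ x, ∫⁻ y, gagliardoKernel s g x y := by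
  have hw := measurable_gagliardoWeight s
  have h1 : gagliardo s g = ∫⁻ v, ∫⁻ x, gagliardoWeight s v * ‖g (x + v) - g x‖ₑ ^ 2 :=
    lintegral_congr fun v => by rw [lintegral_const_mul _ (by fun_prop)]
  rw [h1, lintegral_lintegral_swap (by unfold Function.uncurry; fun_prop)]
  refine lintegral_congr fun x => ?_
  rw [← lintegral_add_left_eq_self (gagliardoKernel s g x) x]
  refine lintegral_congr fun v => ?_
  rw [gagliardoKernel, add_sub_cancel_left]

/-- Substitute `x = e^t`, `y = e^{t+v}`. The kernel is homogeneous in `x - y = e^t (1 - e^v)`, and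
`e^{t/2} (g(x) - g(y))` is the increment `logIncr`. The powers of `e^t` left over combine to
`e^{-2st}`. -/
theorem lintegral_Ioi_gagliardoKernel (s : ℝ) {g : ℝ → ℂ} (hg : Measurable g) :
    ∫⁻ x in Ioi 0, ∫⁻ y in Ioi 0, gagliardoKernel s g x y =
      logGagliardo s fun t => (Real.exp (t / 2) : ℂ) * g (Real.exp t) := by
  have hw := measurable_gagliardoWeight s
  have hlw := measurable_logWeight s
  have h1 : ∀ t v : ℝ, ENNReal.ofReal (Real.exp t) * (ENNReal.ofReal (Real.exp (t + v)) *
      gagliardoKernel s g (Real.exp t) (Real.exp (t + v))) =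
      logWeight s v * (ENNReal.ofReal (Real.exp (-(2 * s * t))) *
        ‖logIncr (fun t => (Real.exp (t / 2) : ℂ) * g (Real.exp t)) v t‖ₑ ^ 2) := by
    intro t v
    have e1 : logIncr (fun t => (Real.exp (t / 2) : ℂ) * g (Real.exp t)) v t =
        (Real.exp (t / 2) : ℂ) * (g (Real.exp t) - g (Real.exp (t + v))) := by
      simp only [logIncr]
      rw [← mul_assoc, ← Complex.ofReal_mul, ← Real.exp_add, mul_sub]
      congr 4
      ring_nf
    have e2 : gagliardoKernel s g (Real.exp t) (Real.exp (t + v)) =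
        ENNReal.ofReal (Real.exp (t * (-1 - 2 * s))) * gagliardoWeight s (1 - Real.exp v) *
          ‖g (Real.exp t) - g (Real.exp (t + v))‖ₑ ^ 2 := by
      rw [gagliardoKernel_comm, gagliardoKernel, ← gagliardoWeight_exp, ← gagliardoWeight_mul,
        Real.exp_add]
      congr 2
      ring
    have e3 : ENNReal.ofReal (Real.exp t) * ENNReal.ofReal (Real.exp (t + v)) *
        ENNReal.ofReal (Real.exp (t * (-1 - 2 * s))) =
        ENNReal.ofReal (Real.exp v) * ENNReal.ofReal (Real.exp (-(2 * s * t))) *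
          ENNReal.ofReal (Real.exp t) := by
      rw [← ENNReal.ofReal_mul (by positivity), ← ENNReal.ofReal_mul (by positivity),
        ← ENNReal.ofReal_mul (by positivity), ← ENNReal.ofReal_mul (by positivity),
        ← Real.exp_add, ← Real.exp_add, ← Real.exp_add, ← Real.exp_add]
      congr 2
      ring
    rw [e1, e2, enorm_mul, mul_pow, enorm_ofReal_exp_sq, mul_div_cancel₀ t two_ne_zero, logWeight]
    calc _ = (ENNReal.ofReal (Real.exp t) * ENNReal.ofReal (Real.exp (t + v)) *
        ENNReal.ofReal (Real.exp (t * (-1 - 2 * s)))) * gagliardoWeight s (1 - Real.exp v) *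
          ‖g (Real.exp t) - g (Real.exp (t + v))‖ₑ ^ 2 := by ring
      _ = _ := by rw [e3]; ring
  have hincr : Measurable (Function.uncurry fun t v : ℝ =>
      logIncr (fun t => (Real.exp (t / 2) : ℂ) * g (Real.exp t)) v t) := by
    unfold logIncr Function.uncurry
    fun_prop
  calc ∫⁻ x in Ioi 0, ∫⁻ y in Ioi 0, gagliardoKernel s g x y
      = ∫⁻ t, ∫⁻ v, ENNReal.ofReal (Real.exp t) * (ENNReal.ofReal (Real.exp (t + v)) *
          gagliardoKernel s g (Real.exp t) (Real.exp (t + v))) := by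
        rw [← lintegral_exp_mul_comp_exp]
        refine lintegral_congr fun t => ?_
        have hk : Measurable (gagliardoKernel s g (Real.exp t)) :=
          (measurable_gagliardoKernel s hg).of_uncurry_left
        have hk' : Measurable fun u => ENNReal.ofReal (Real.exp u) *
            gagliardoKernel s g (Real.exp t) (Real.exp u) := by fun_prop
        rw [← lintegral_exp_mul_comp_exp, ← lintegral_const_mul _ hk',
          ← lintegral_add_left_eq_self _ t]
    _ = ∫⁻ t, ∫⁻ v, logWeight s v * (ENNReal.ofReal (Real.exp (-(2 * s * t))) *
        ‖logIncr (fun t => (Real.exp (t / 2) : ℂ) * g (Real.exp t)) v t‖ₑ ^ 2) := by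
        simp only [h1]
    _ = ∫⁻ v, ∫⁻ t, logWeight s v * (ENNReal.ofReal (Real.exp (-(2 * s * t))) *
        ‖logIncr (fun t => (Real.exp (t / 2) : ℂ) * g (Real.exp t)) v t‖ₑ ^ 2) := by
        refine lintegral_lintegral_swap (Measurable.aemeasurable ?_)
        unfold Function.uncurry at hincr ⊢
        fun_prop
    _ = _ := by
        refine lintegral_congr fun v => ?_
        rw [lintegral_const_mul]
        · rfl
        · unfold logIncr
          fun_prop

/-- The left side is the part of the double integral over the quadrant `x, y > 0`. -/
theorem logGagliardo_toLog_le (s : ℝ) (g : L2R) : logGagliardo s (toLog g) ≤ gagliardo s g := by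
  rw [logGagliardo_congr (coeFn_toLog g), ← lintegral_Ioi_gagliardoKernel s (measurable_coeFn g),
    gagliardo_eq_lintegral_kernel s (measurable_coeFn g)]
  exact (setLIntegral_le_lintegral _ _).trans
    (lintegral_mono fun x => setLIntegral_le_lintegral _ _)

/-- This is the interaction of a point `x > 0` with the half-line where a zero extension vanishes;
it produces the Hardy weight `x^{-2s}`. -/
theorem lintegral_Iic_gagliardoWeight {s : ℝ} (hs : 0 < s) {x : ℝ} (hx : 0 < x) :
    ∫⁻ y in Iic 0, gagliardoWeight s (y - x) =
      ENNReal.ofReal (1 / (2 * s)) * ENNReal.ofReal (x ^ (-(2 * s))) := by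
  have h1 : ∫⁻ y in Iic 0, gagliardoWeight s (y - x) = ∫⁻ v in Ici x, gagliardoWeight s v := by
    rw [← lintegral_indicator measurableSet_Iic, ← lintegral_indicator measurableSet_Ici,
      ← lintegral_sub_left_eq_self _ x]
    refine lintegral_congr fun v => ?_
    by_cases hv : v ∈ Ici x
    · rw [indicator_of_mem hv, indicator_of_mem (show x - v ∈ Iic (0 : ℝ) from sub_nonpos.2 (mem_Ici.1 hv)),
        ← gagliardoWeight_neg]
      congr 1
      ring
    · rw [indicator_of_notMem hv, indicator_of_notMem]
      exact fun h => hv (mem_Ici.2 (sub_nonpos.1 (mem_Iic.1 h)))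
  rw [h1, ← restrict_Ioi_eq_restrict_Ici]
  have h2 : ∫⁻ v in Ioi x, gagliardoWeight s v = ∫⁻ v in Ioi x, ENNReal.ofReal (v ^ (-1 - 2 * s)) :=
    setLIntegral_congr_fun measurableSet_Ioi fun v hv => by
      rw [gagliardoWeight, abs_of_pos (hx.trans hv)]
  rw [h2, lintegral_Ioi_rpow (by linarith) hx, ← ENNReal.ofReal_mul (by positivity)]
  congr 1
  have : -1 - 2 * s + 1 = -(2 * s) := by ring
  rw [this]
  field_simp

/-- Split the double integral into four quadrants. The positive one gives `logGagliardo`, the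
negative one vanishes, and each mixed one gives `1/(2s)` times the Hardy term `∫ x^{-2s} |k|² dx`,
which is `logNorm s h`. -/
theorem gagliardo_ofLog {s : ℝ} (hs : 0 < s) (h : L2R) :
    gagliardo s (ofLog h) = logGagliardo s h + ENNReal.ofReal (1 / s) * logNorm s h := by
  set k : ℝ → ℂ := (Ioi 0).indicator fun x => (Real.exp (-(Real.log x / 2)) : ℂ) * h (Real.log x)
    with hk
  have hh := measurable_coeFn h
  have hkm : Measurable k := by
    have : Measurable fun x => (Real.exp (-(Real.log x / 2)) : ℂ) * h (Real.log x) := by fun_prop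
    exact this.indicator measurableSet_Ioi
  have hk0 : ∀ x ∈ Iic (0 : ℝ), k x = 0 := fun x hx => indicator_of_notMem (not_lt.2 hx) _
  have hkexp : (fun t => (Real.exp (t / 2) : ℂ) * k (Real.exp t)) = h := by
    funext t
    rw [hk, indicator_of_mem (show Real.exp t ∈ Ioi (0 : ℝ) from Real.exp_pos t), Real.log_exp,
      ← mul_assoc, ← Complex.ofReal_mul, ← Real.exp_add]
    simp
  have hKm := measurable_gagliardoKernel s hkm
  have hA : ∫⁻ x in Ioi 0, ∫⁻ y in Ioi 0, gagliardoKernel s k x y = logGagliardo s h := by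
    rw [lintegral_Ioi_gagliardoKernel s hkm, hkexp]
  have hB : ∫⁻ x in Ioi 0, ∫⁻ y in Iic 0, gagliardoKernel s k x y =
      ENNReal.ofReal (1 / (2 * s)) * logNorm s h := by
    have h1 : ∀ x ∈ Ioi (0 : ℝ), ∫⁻ y in Iic 0, gagliardoKernel s k x y =
        ENNReal.ofReal (1 / (2 * s)) * (ENNReal.ofReal (x ^ (-(2 * s))) * ‖k x‖ₑ ^ 2) := by
      intro x hx
      have hw := measurable_gagliardoWeight s
      rw [← mul_assoc, ← lintegral_Iic_gagliardoWeight hs hx, ← lintegral_mul_const _ (by fun_prop)]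
      refine setLIntegral_congr_fun measurableSet_Iic fun y hy => ?_
      simp only [gagliardoKernel]
      rw [hk0 y hy, zero_sub, enorm_neg]
    rw [setLIntegral_congr_fun measurableSet_Ioi h1, lintegral_const_mul _ (by fun_prop),
      ← lintegral_exp_mul_comp_exp, logNorm]
    congr 1
    refine lintegral_congr fun t => ?_
    conv_rhs => rw [← hkexp, enorm_mul, mul_pow, enorm_ofReal_exp_sq, mul_div_cancel₀ t two_ne_zero]
    rw [← Real.exp_mul, mul_left_comm]
    congr 4
    ring
  have hC : ∫⁻ x in Iic 0, ∫⁻ y in Ioi 0, gagliardoKernel s k x y =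
      ENNReal.ofReal (1 / (2 * s)) * logNorm s h := by
    rw [← hB, lintegral_lintegral_swap hKm.aemeasurable]
    simp only [gagliardoKernel_comm s k]
  have hD : ∫⁻ x in Iic 0, ∫⁻ y in Iic 0, gagliardoKernel s k x y = 0 := by
    have h1 : ∀ x ∈ Iic (0 : ℝ), ∫⁻ y in Iic 0, gagliardoKernel s k x y = 0 := by
      intro x hx
      rw [setLIntegral_congr_fun (g := fun _ => 0) measurableSet_Iic fun y hy => ?_]
      · simp
      · simp only [gagliardoKernel]
        rw [hk0 y hy, hk0 x hx]
        simp
    rw [setLIntegral_congr_fun measurableSet_Iic h1]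
    simp
  have hsplit : ∀ F : ℝ → ℝ≥0∞, ∫⁻ x, F x = (∫⁻ x in Ioi 0, F x) + ∫⁻ x in Iic 0, F x := by
    intro F
    rw [← lintegral_add_compl F (measurableSet_Ioi (a := (0 : ℝ))), compl_Ioi]
  have hm1 : Measurable fun x => ∫⁻ y in Ioi 0, gagliardoKernel s k x y :=
    hKm.lintegral_prod_right
  rw [gagliardo_congr (coeFn_ofLog h), ← hk, gagliardo_eq_lintegral_kernel s hkm, hsplit]
  simp only [hsplit (gagliardoKernel s k _)]
  rw [lintegral_add_left hm1, lintegral_add_left hm1, hA, hB, hC, hD, add_zero, add_assoc,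
    ← add_mul, ← ENNReal.ofReal_add (by positivity) (by positivity)]
  congr 3
  field_simp
  ring

/-! ### The fractional Hardy inequality -/

/-- Young's inequality with a parameter: the coefficient of `b` can be brought as close to `1` as an
absorption argument requires. -/
theorem enorm_add_sq_le {η : ℝ} (hη : 0 < η) (a b : ℂ) :
    ‖a + b‖ₑ ^ 2 ≤ ENNReal.ofReal (1 + η⁻¹) * ‖a‖ₑ ^ 2 + ENNReal.ofReal (1 + η) * ‖b‖ₑ ^ 2 := by
  rw [← ofReal_norm, ← ofReal_norm, ← ofReal_norm, ← ENNReal.ofReal_pow (norm_nonneg _),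
    ← ENNReal.ofReal_pow (norm_nonneg _), ← ENNReal.ofReal_pow (norm_nonneg _),
    ← ENNReal.ofReal_mul (by positivity), ← ENNReal.ofReal_mul (by positivity),
    ← ENNReal.ofReal_add (by positivity) (by positivity)]
  refine ENNReal.ofReal_le_ofReal ?_
  have h1 : ‖a + b‖ ^ 2 ≤ (‖a‖ + ‖b‖) ^ 2 := pow_le_pow_left₀ (norm_nonneg _) (norm_add_le a b) 2
  have h2 : (1 + η⁻¹) * ‖a‖ ^ 2 + (1 + η) * ‖b‖ ^ 2 - (‖a‖ + ‖b‖) ^ 2 =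
      η⁻¹ * (‖a‖ - η * ‖b‖) ^ 2 := by
    field_simp
    ring
  have h3 : 0 ≤ η⁻¹ * (‖a‖ - η * ‖b‖) ^ 2 := by positivity
  linarith

/-- Write `h` as its increment plus `e^{-v/2} h(· + v)`. The latter has squared weighted norm
`e^{-(1-2s)v}` times that of `h`. For `s < 1/2` and `v ≥ 1` this factor is at most `r < 1`, so the
term can be absorbed. -/
theorem logNorm_le_logNorm_logIncr {s : ℝ} (hs₀ : 0 ≤ s) (hs₁ : s < 1 / 2) :
    ∃ C : ℝ≥0∞, C ≠ ∞ ∧ ∀ h : ℝ → ℂ, Measurable h → ∫⁻ t, ‖h t‖ₑ ^ 2 ≠ ∞ → ∀ v, 1 ≤ v →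
      logNorm s h ≤ C * logNorm s (logIncr h v) := by
  set r := Real.exp (-(1 - 2 * s)) with hr
  have hr0 : 0 < r := Real.exp_pos _
  have hr1 : r < 1 := Real.exp_lt_one_iff.2 (by linarith)
  -- The parameter puts `(1 + η) r` halfway between `r` and `1`, leaving the margin `(1 - r)/2` for
  -- absorption.
  obtain ⟨η, hη, hηr⟩ : ∃ η : ℝ, 0 < η ∧ (1 + η) * r = (1 + r) / 2 :=
    ⟨(1 - r) / (2 * r), div_pos (by linarith) (by linarith), by field_simp; ring⟩
  refine ⟨ENNReal.ofReal (2 / (1 - r)) * ENNReal.ofReal (1 + η⁻¹),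
    ENNReal.mul_ne_top ENNReal.ofReal_ne_top ENNReal.ofReal_ne_top, fun h hh hfin v hv => ?_⟩
  have hcov : AECover volume atTop fun n : ℕ => Ici (-(n : ℝ)) :=
    aecover_Ici (tendsto_neg_atTop_atBot.comp tendsto_natCast_atTop_atTop)
  -- Absorption needs a finite quantity. On `[-n, ∞)` the weight is at most `e^{2sn}`, so `h ∈ L²`
  -- suffices; moreover this half-line is preserved by `t ↦ t + v`, so the shifted term is bounded
  -- by the same truncated norm.
  have hmain : ∀ n : ℕ, ∫⁻ t in Ici (-(n : ℝ)), ENNReal.ofReal (Real.exp (-(2 * s * t))) * ‖h t‖ₑ ^ 2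
      ≤ ENNReal.ofReal (2 / (1 - r)) * ENNReal.ofReal (1 + η⁻¹) * logNorm s (logIncr h v) := by
    intro n
    set A := Ici (-(n : ℝ)) with hA
    set N := ∫⁻ t in A, ENNReal.ofReal (Real.exp (-(2 * s * t))) * ‖h t‖ₑ ^ 2 with hN
    have hNfin : N ≠ ∞ := by
      refine ne_top_of_le_ne_top (b := ENNReal.ofReal (Real.exp (2 * s * n)) * ∫⁻ t, ‖h t‖ₑ ^ 2)
        (ENNReal.mul_ne_top ENNReal.ofReal_ne_top hfin) ?_
      rw [← lintegral_const_mul _ (by fun_prop)]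
      refine (setLIntegral_mono' measurableSet_Ici fun t ht => ?_).trans
        (setLIntegral_le_lintegral A _)
      refine mul_le_mul_left (ENNReal.ofReal_le_ofReal (Real.exp_le_exp.2 ?_)) _
      have := mul_le_mul_of_nonneg_left (mem_Ici.1 ht) (by positivity : 0 ≤ 2 * s)
      linarith
    have hshift : ∫⁻ t in A, ENNReal.ofReal (Real.exp (-(2 * s * t))) *
        ‖(Real.exp (-(v / 2)) : ℂ) * h (t + v)‖ₑ ^ 2 ≤ ENNReal.ofReal r * N := by
      have e1 : ∀ t, ENNReal.ofReal (Real.exp (-(2 * s * t))) *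
          ‖(Real.exp (-(v / 2)) : ℂ) * h (t + v)‖ₑ ^ 2 =
          ENNReal.ofReal (Real.exp (-(1 - 2 * s) * v)) *
            (ENNReal.ofReal (Real.exp (-(2 * s * (t + v)))) * ‖h (t + v)‖ₑ ^ 2) := by
        intro t
        rw [enorm_mul, mul_pow, enorm_ofReal_exp_sq, ← mul_assoc, ← mul_assoc,
          ← ENNReal.ofReal_mul (by positivity), ← ENNReal.ofReal_mul (by positivity),
          ← Real.exp_add, ← Real.exp_add]
        congr 3
        ring
      simp only [e1]
      rw [lintegral_const_mul _ (by fun_prop)]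
      refine mul_le_mul' (ENNReal.ofReal_le_ofReal (Real.exp_le_exp.2 ?_)) ?_
      · nlinarith
      · rw [hN, ← lintegral_indicator measurableSet_Ici, ← lintegral_indicator measurableSet_Ici,
          ← lintegral_add_right_eq_self (A.indicator fun t =>
            ENNReal.ofReal (Real.exp (-(2 * s * t))) * ‖h t‖ₑ ^ 2) v]
        refine lintegral_mono fun t => ?_
        by_cases ht : t ∈ A
        · have ht' : t + v ∈ A := by
            rw [hA, mem_Ici] at ht ⊢
            linarith
          rw [indicator_of_mem ht, indicator_of_mem ht']
        · rw [indicator_of_notMem ht]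
          exact zero_le
    have hle : N ≤ ENNReal.ofReal (1 + η⁻¹) * logNorm s (logIncr h v) +
        ENNReal.ofReal ((1 + r) / 2) * N := by
      have hmi : Measurable (logIncr h v) := by unfold logIncr; fun_prop
      calc N ≤ ∫⁻ t in A, (ENNReal.ofReal (1 + η⁻¹) *
            (ENNReal.ofReal (Real.exp (-(2 * s * t))) * ‖logIncr h v t‖ₑ ^ 2) +
            ENNReal.ofReal (1 + η) * (ENNReal.ofReal (Real.exp (-(2 * s * t))) *
              ‖(Real.exp (-(v / 2)) : ℂ) * h (t + v)‖ₑ ^ 2)) := by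
            refine lintegral_mono fun t => ?_
            have e1 : h t = logIncr h v t + (Real.exp (-(v / 2)) : ℂ) * h (t + v) := by
              rw [logIncr, sub_add_cancel]
            have e2 := enorm_add_sq_le hη (logIncr h v t) ((Real.exp (-(v / 2)) : ℂ) * h (t + v))
            rw [← e1] at e2
            refine (mul_le_mul_right e2 _).trans (le_of_eq ?_)
            ring
        _ = ENNReal.ofReal (1 + η⁻¹) * (∫⁻ t in A,
            (ENNReal.ofReal (Real.exp (-(2 * s * t))) * ‖logIncr h v t‖ₑ ^ 2)) +
            ENNReal.ofReal (1 + η) * ∫⁻ t in A, (ENNReal.ofReal (Real.exp (-(2 * s * t))) *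
              ‖(Real.exp (-(v / 2)) : ℂ) * h (t + v)‖ₑ ^ 2) := by
            rw [lintegral_add_left (by fun_prop), lintegral_const_mul _ (by fun_prop),
              lintegral_const_mul _ (by fun_prop)]
        _ ≤ ENNReal.ofReal (1 + η⁻¹) * logNorm s (logIncr h v) +
            ENNReal.ofReal (1 + η) * (ENNReal.ofReal r * N) := by
            gcongr
            exact setLIntegral_le_lintegral _ _
        _ = _ := by
            rw [← mul_assoc (ENNReal.ofReal (1 + η)), ← ENNReal.ofReal_mul (by positivity), hηr]
    rcases eq_or_ne (logNorm s (logIncr h v)) ∞ with htop | htop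
    · rw [htop, ENNReal.mul_top]
      · exact le_top
      · refine mul_ne_zero ?_ ?_
        · exact (ENNReal.ofReal_pos.2 (div_pos two_pos (by linarith))).ne'
        · exact (ENNReal.ofReal_pos.2 (by positivity)).ne'
    · rw [← ENNReal.ofReal_toReal hNfin, ← ENNReal.ofReal_toReal htop,
        ← ENNReal.ofReal_mul (by positivity), ← ENNReal.ofReal_mul (by positivity),
        ← ENNReal.ofReal_add (by positivity) (by positivity),
        ENNReal.ofReal_le_ofReal_iff (by positivity)] at hle
      rw [← ENNReal.ofReal_toReal hNfin, ← ENNReal.ofReal_toReal htop, mul_assoc,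
        ← ENNReal.ofReal_mul (by positivity),
        ← ENNReal.ofReal_mul (div_nonneg two_pos.le (by linarith))]
      refine ENNReal.ofReal_le_ofReal ?_
      rw [div_mul_eq_mul_div, le_div_iff₀ (by linarith)]
      linarith
  refine le_of_tendsto' (hcov.lintegral_tendsto_of_countably_generated ?_) hmain
  exact (by fun_prop : Measurable fun t => ENNReal.ofReal (Real.exp (-(2 * s * t))) * ‖h t‖ₑ ^ 2).aemeasurable

/-- The fractional Hardy inequality on `(0, ∞)`, in logarithmic coordinates. -/
theorem exists_logNorm_le_logGagliardo {s : ℝ} (hs₀ : 0 ≤ s) (hs₁ : s < 1 / 2) :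
    ∃ C : ℝ≥0∞, C ≠ ∞ ∧ ∀ h : L2R, logNorm s h ≤ C * logGagliardo s h := by
  obtain ⟨C, hC, hle⟩ := logNorm_le_logNorm_logIncr hs₀ hs₁
  -- A lower bound for `logWeight s` on `[1, 2]`, where `0 < e^v - 1 ≤ e²`. Averaging the previous
  -- inequality over this interval of length one gives the Hardy inequality.
  set c := ENNReal.ofReal (Real.exp (2 * (-1 - 2 * s))) with hc
  have hc0 : c ≠ 0 := (ENNReal.ofReal_pos.2 (Real.exp_pos _)).ne'
  refine ⟨c⁻¹ * C, ENNReal.mul_ne_top (ENNReal.inv_ne_top.2 hc0) hC, fun h => ?_⟩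
  have hfin : ∫⁻ t, ‖h t‖ₑ ^ 2 ≠ ∞ := by rw [lintegral_enorm_sq]; simp
  have hw : ∀ v ∈ Icc (1 : ℝ) 2, c ≤ logWeight s v := by
    intro v hv
    have h1 : 0 < Real.exp v - 1 := by
      have := Real.add_one_le_exp v
      linarith [hv.1]
    have h2 : Real.exp v - 1 ≤ Real.exp 2 := by
      have := Real.exp_le_exp.2 hv.2
      linarith
    rw [logWeight, gagliardoWeight, ← ENNReal.ofReal_mul (by positivity), abs_sub_comm,
      abs_of_pos h1, hc]
    refine ENNReal.ofReal_le_ofReal ?_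
    have h3 : Real.exp (2 * (-1 - 2 * s)) ≤ (Real.exp v - 1) ^ (-1 - 2 * s) := by
      rw [Real.exp_mul]
      exact Real.rpow_le_rpow_of_nonpos h1 h2 (by linarith)
    have h4 : 1 ≤ Real.exp v := Real.one_le_exp (by linarith [hv.1])
    exact h3.trans (le_mul_of_one_le_left (by positivity) h4)
  have hkey : c * logNorm s h ≤ C * logGagliardo s h := by
    calc c * logNorm s h = ∫⁻ _ in Icc (1 : ℝ) 2, c * logNorm s h := by
          rw [setLIntegral_const, Real.volume_Icc]
          norm_num
      _ ≤ ∫⁻ v in Icc (1 : ℝ) 2, C * (logWeight s v * logNorm s (logIncr h v)) := by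
          refine setLIntegral_mono' measurableSet_Icc fun v hv => ?_
          refine (mul_le_mul' (hw v hv) (hle h (measurable_coeFn h) hfin v hv.1)).trans
            (le_of_eq ?_)
          ring
      _ ≤ ∫⁻ v, C * (logWeight s v * logNorm s (logIncr h v)) := setLIntegral_le_lintegral _ _
      _ = C * logGagliardo s h := lintegral_const_mul' _ _ hC
  calc logNorm s h = c⁻¹ * (c * logNorm s h) := by
        rw [← mul_assoc, ENNReal.inv_mul_cancel hc0 ENNReal.ofReal_ne_top, one_mul]
    _ ≤ c⁻¹ * (C * logGagliardo s h) := mul_le_mul_right hkey _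
    _ = _ := by rw [mul_assoc]

/-! ### Translation invariant operators and the Gagliardo seminorm -/

theorem coeFn_sub_smul_translate (v : ℝ) (h : L2R) :
    (h - (Real.exp (-(v / 2)) : ℂ) • translate v h : L2R) =ᵐ[volume] logIncr h v := by
  filter_upwards [Lp.coeFn_sub h ((Real.exp (-(v / 2)) : ℂ) • translate v h),
    Lp.coeFn_smul (Real.exp (-(v / 2)) : ℂ) (translate v h), coeFn_translate v h] with t h1 h2 h3
  rw [h1, Pi.sub_apply, h2, Pi.smul_apply, h3, smul_eq_mul, logIncr]

/-- As `T` commutes with translations, the increment of `T h` is `T` applied to the increment of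
`h`; use the weighted bound for each `v` and integrate. -/
theorem logGagliardo_map_le {s : ℝ} {B : ℝ≥0∞} (hB : B ≠ ∞) (T : L2R →L[ℂ] L2R)
    (hT : ∀ v h, T (translate v h) = translate v (T h))
    (hTB : ∀ h : L2R, logNorm s (T h) ≤ B * logNorm s h) (h : L2R) :
    logGagliardo s (T h) ≤ B * logGagliardo s h := by
  unfold logGagliardo
  rw [← lintegral_const_mul' _ _ hB]
  refine lintegral_mono fun v => ?_
  have h1 := hTB (h - (Real.exp (-(v / 2)) : ℂ) • translate v h)
  rw [map_sub, map_smul, hT, logNorm_congr (coeFn_sub_smul_translate v h),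
    logNorm_congr (coeFn_sub_smul_translate v (T h))] at h1
  exact (mul_le_mul_right h1 _).trans (le_of_eq (by ring))

/-- A translation invariant operator in logarithmic coordinates which is bounded for the weighted
norm is bounded for the Gagliardo seminorm. -/
theorem exists_gagliardo_ofLog_le {s : ℝ} (hs₀ : 0 < s) (hs₁ : s < 1 / 2) :
    ∃ C : ℝ≥0∞, C ≠ ∞ ∧ ∀ B : ℝ≥0∞, B ≠ ∞ → ∀ T : L2R →L[ℂ] L2R,
      (∀ v h, T (translate v h) = translate v (T h)) →
      (∀ h : L2R, logNorm s (T h) ≤ B * logNorm s h) →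
      ∀ g : L2R, gagliardo s (ofLog (T (toLog g))) ≤ C * B * gagliardo s g := by
  obtain ⟨C, hC, hle⟩ := exists_logNorm_le_logGagliardo hs₀.le hs₁
  -- The `1` accounts for the seminorm on the half-line, the other summand for the zero extension,
  -- estimated by Hardy's inequality.
  refine ⟨1 + ENNReal.ofReal (1 / s) * C, by simp [ENNReal.mul_eq_top, hC], fun B hB T hT hTB g => ?_⟩
  rw [gagliardo_ofLog hs₀]
  calc logGagliardo s (T (toLog g)) + ENNReal.ofReal (1 / s) * logNorm s (T (toLog g))
      ≤ logGagliardo s (T (toLog g)) +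
          ENNReal.ofReal (1 / s) * (C * logGagliardo s (T (toLog g))) := by
        gcongr
        exact hle _
    _ = (1 + ENNReal.ofReal (1 / s) * C) * logGagliardo s (T (toLog g)) := by ring
    _ ≤ (1 + ENNReal.ofReal (1 / s) * C) * (B * gagliardo s g) := by
        gcongr
        refine (logGagliardo_map_le hB T hT hTB _).trans ?_
        gcongr
        exact logGagliardo_toLog_le s g
    _ = _ := by ring

/-! ### Contour shift in a strip -/

/-- Shifting the line of integration of a bounded holomorphic function on a strip. -/
theorem integral_eq_integral_sub_mul_I {G : ℂ → ℂ} {σ K : ℝ} (hσ : 0 ≤ σ)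
    (hd : ∀ z : ℂ, -σ ≤ z.im → z.im ≤ 0 → DifferentiableAt ℂ G z)
    (hb : ∀ z : ℂ, -σ ≤ z.im → z.im ≤ 0 → ‖G z‖ ≤ K)
    (h0 : Integrable fun ξ : ℝ => G ξ) (h1 : Integrable fun ξ : ℝ => G (ξ - σ * Complex.I)) :
    ∫ ξ : ℝ, G ξ = ∫ ξ : ℝ, G (ξ - σ * Complex.I) := by
  -- `G` is merely bounded, so the vertical sides of a rectangle need not tend to zero. The Gaussian
  -- factor `e^{-εz²}`, bounded on the strip by `e^{εσ²} e^{-ε (Re z)²}`, forces this; it is removed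
  -- at the end by dominated convergence along `ε = 1/(n+1)`.
  set E : ℝ → ℂ → ℂ := fun ε z => Complex.exp (-(ε * z ^ 2)) with hE
  have hEnorm : ∀ ε : ℝ, 0 ≤ ε → ∀ z : ℂ, -σ ≤ z.im → z.im ≤ 0 →
      ‖E ε z‖ ≤ Real.exp (ε * σ ^ 2) * Real.exp (-(ε * z.re ^ 2)) := by
    intro ε hε z hz1 hz2
    rw [hE, Complex.norm_exp, ← Real.exp_add]
    refine Real.exp_le_exp.2 ?_
    have e1 : (-(ε * z ^ 2) : ℂ).re = ε * z.im ^ 2 + -(ε * z.re ^ 2) := by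
      simp [pow_two, Complex.mul_re]
      ring
    rw [e1]
    have : z.im ^ 2 ≤ σ ^ 2 := by nlinarith
    nlinarith [mul_le_mul_of_nonneg_left this hε]
  have hEnorm' : ∀ ε : ℝ, 0 ≤ ε → ∀ z : ℂ, -σ ≤ z.im → z.im ≤ 0 →
      ‖E ε z‖ ≤ Real.exp (ε * σ ^ 2) := by
    intro ε hε z hz1 hz2
    refine (hEnorm ε hε z hz1 hz2).trans (mul_le_of_le_one_right (Real.exp_pos _).le ?_)
    rw [Real.exp_le_one_iff]
    nlinarith [mul_nonneg hε (sq_nonneg z.re)]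
  have him0 : ∀ ξ : ℝ, (-σ ≤ (ξ : ℂ).im) ∧ ((ξ : ℂ).im ≤ 0) := fun ξ => by simpa using hσ
  have him1 : ∀ ξ : ℝ, (-σ ≤ (ξ - σ * Complex.I : ℂ).im) ∧ ((ξ - σ * Complex.I : ℂ).im ≤ 0) :=
    fun ξ => by simpa using hσ
  have hEcont : ∀ ε, Continuous (E ε) := fun ε => by
    rw [hE]
    fun_prop
  have hline : ∀ (ℓ : ℝ → ℂ), Continuous ℓ → (∀ ξ, -σ ≤ (ℓ ξ).im ∧ (ℓ ξ).im ≤ 0) →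
      Integrable (fun ξ => G (ℓ ξ)) → ∀ ε, 0 ≤ ε → Integrable fun ξ => E ε (ℓ ξ) * G (ℓ ξ) := by
    intro ℓ hℓ hℓs hi ε hε
    exact hi.bdd_mul ((hEcont ε).comp hℓ).aestronglyMeasurable
      (Eventually.of_forall fun ξ => hEnorm' ε hε _ (hℓs ξ).1 (hℓs ξ).2)
  have hc0 : Continuous fun ξ : ℝ => (ξ : ℂ) := by fun_prop
  have hc1 : Continuous fun ξ : ℝ => (ξ - σ * Complex.I : ℂ) := by fun_prop
  have hlim : ∀ (ℓ : ℝ → ℂ), Continuous ℓ → (∀ ξ, -σ ≤ (ℓ ξ).im ∧ (ℓ ξ).im ≤ 0) →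
      Integrable (fun ξ => G (ℓ ξ)) →
      Tendsto (fun n : ℕ => ∫ ξ, E (1 / ((n : ℝ) + 1)) (ℓ ξ) * G (ℓ ξ)) atTop
        (nhds (∫ ξ, G (ℓ ξ))) := by
    intro ℓ hℓ hℓs hi
    refine tendsto_integral_of_dominated_convergence (fun ξ => Real.exp (σ ^ 2) * ‖G (ℓ ξ)‖)
      (fun n => (hline ℓ hℓ hℓs hi _ (by positivity)).aestronglyMeasurable)
      (hi.norm.const_mul _) (fun n => Eventually.of_forall fun ξ => ?_)
      (Eventually.of_forall fun ξ => ?_)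
    · rw [norm_mul]
      refine mul_le_mul_of_nonneg_right ((hEnorm' _ (by positivity) _ (hℓs ξ).1 (hℓs ξ).2).trans
        (Real.exp_le_exp.2 ?_)) (norm_nonneg _)
      refine mul_le_of_le_one_left (sq_nonneg σ) ?_
      rw [div_le_one (by positivity)]
      linarith [Nat.cast_nonneg (α := ℝ) n]
    · have e1 : Tendsto (fun n : ℕ => ((1 / ((n : ℝ) + 1) : ℝ) : ℂ)) atTop (nhds ((0 : ℝ) : ℂ)) :=
        (Complex.continuous_ofReal.tendsto 0).comp tendsto_one_div_add_atTop_nhds_zero_nat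
      have e2 : Continuous fun w : ℂ => Complex.exp (-(w * (ℓ ξ) ^ 2)) * G (ℓ ξ) := by fun_prop
      have e3 := (e2.tendsto ((0 : ℝ) : ℂ)).comp e1
      simpa [hE, Function.comp_def] using e3
  have hshift : ∀ ε : ℝ, 0 < ε → ∫ ξ : ℝ, E ε ξ * G ξ =
      ∫ ξ : ℝ, E ε (ξ - σ * Complex.I) * G (ξ - σ * Complex.I) := by
    intro ε hε
    have hrect : ∀ R : ℝ, (∫ x in (-R)..R, E ε (x - σ * Complex.I) * G (x - σ * Complex.I)) -
        (∫ x in (-R)..R, E ε x * G x) = - (Complex.I • ∫ y in (-σ)..0, E ε (R + y * Complex.I) *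
          G (R + y * Complex.I)) + Complex.I • ∫ y in (-σ)..0, E ε (-R + y * Complex.I) *
          G (-R + y * Complex.I) := by
      intro R
      have h := Complex.integral_boundary_rect_eq_zero_of_differentiableOn
        (fun z => E ε z * G z) (-R - σ * Complex.I) R (by
          intro z hz
          have hz' := hz.2
          simp only [mem_preimage, Complex.sub_im, Complex.neg_im, Complex.ofReal_im,
            Complex.mul_im, Complex.ofReal_re, Complex.I_im, Complex.I_re, mul_one, mul_zero,
            neg_zero, add_zero, zero_sub] at hz'
          rw [uIcc_of_le (by linarith)] at hz'
          have hEd : DifferentiableAt ℂ (E ε) z := by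
            rw [hE]
            fun_prop
          exact (hEd.mul (hd z hz'.1 hz'.2)).differentiableWithinAt)
      simp only [Complex.sub_im, Complex.neg_im, Complex.ofReal_im, Complex.mul_im,
        Complex.ofReal_re, Complex.I_im, Complex.I_re, mul_one, mul_zero, neg_zero, add_zero,
        zero_sub, Complex.sub_re, Complex.neg_re, Complex.mul_re, sub_zero, Complex.ofReal_neg,
        neg_mul, ← sub_eq_add_neg, Complex.ofReal_zero, zero_mul] at h
      linear_combination h
    -- The map `ρ` stands for `R ↦ R` and for `R ↦ -R`, so both vertical sides are treated at once.
    have hside : ∀ ρ : ℝ → ℂ, (∀ R, (ρ R).re ^ 2 = R ^ 2 ∧ (ρ R).im = 0) →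
        Tendsto (fun R => ∫ y in (-σ)..0, E ε (ρ R + y * Complex.I) * G (ρ R + y * Complex.I))
          atTop (nhds 0) := by
      intro ρ hρ
      have hbd : ∀ R, ‖∫ y in (-σ)..0, E ε (ρ R + y * Complex.I) * G (ρ R + y * Complex.I)‖ ≤
          Real.exp (ε * σ ^ 2) * Real.exp (-(ε * R ^ 2)) * K * |0 - -σ| := by
        intro R
        refine intervalIntegral.norm_integral_le_of_norm_le_const fun y hy => ?_
        rw [uIoc_of_le (by linarith)] at hy
        have e1 : (ρ R + y * Complex.I).im = y := by simp [(hρ R).2]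
        have e2 : (ρ R + y * Complex.I).re = (ρ R).re := by simp
        have e3 := hEnorm ε hε.le (ρ R + y * Complex.I) (by rw [e1]; exact hy.1.le)
          (by rw [e1]; exact hy.2)
        rw [e2, (hρ R).1] at e3
        rw [norm_mul]
        exact mul_le_mul e3 (hb _ (by rw [e1]; exact hy.1.le) (by rw [e1]; exact hy.2))
          (norm_nonneg _) (by positivity)
      refine squeeze_zero_norm hbd ?_
      have e1 : Tendsto (fun R : ℝ => Real.exp (-(ε * R ^ 2))) atTop (nhds 0) :=
        Real.tendsto_exp_neg_atTop_nhds_zero.comp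
          ((tendsto_pow_atTop two_ne_zero).const_mul_atTop hε)
      simpa using ((e1.const_mul (Real.exp (ε * σ ^ 2))).mul_const K).mul_const |0 - -σ|
    have hL := (intervalIntegral_tendsto_integral (hline _ hc1 him1 h1 ε hε.le)
      tendsto_neg_atTop_atBot tendsto_id).sub
      (intervalIntegral_tendsto_integral (hline _ hc0 him0 h0 ε hε.le)
      tendsto_neg_atTop_atBot tendsto_id)
    have hR := ((hside (fun R => (R : ℂ)) (fun R => by simp)).const_smul Complex.I).neg.add
      ((hside (fun R => (-R : ℂ)) (fun R => by simp)).const_smul Complex.I)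
    have := tendsto_nhds_unique hL (hR.congr fun R => (hrect R).symm)
    rw [smul_zero, neg_zero, add_zero, sub_eq_zero] at this
    exact this.symm
  refine tendsto_nhds_unique (hlim _ hc0 him0 h0) ((hlim _ hc1 him1 h1).congr fun n => ?_)
  exact (hshift _ (by positivity)).symm

/-! ### Truncated Laplace transforms and exponential weights -/

/-- The Laplace transform `z ↦ ∫ f(t) e^{-2πitz} dt` over `[-n, n]`. -/
def laplace (n : ℕ) (f : ℝ → ℂ) (z : ℂ) : ℂ :=
  ∫ t in Icc (-(n : ℝ)) n, f t * Complex.exp (-(2 * π * t * Complex.I) * z)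

theorem norm_exp_neg_two_pi_mul_le {n : ℕ} {t : ℝ} (ht : t ∈ Icc (-(n : ℝ)) n) {z : ℂ} {σ : ℝ}
    (hz : |z.im| ≤ σ) :
    ‖Complex.exp (-(2 * π * t * Complex.I) * z)‖ ≤ Real.exp (2 * π * n * σ) := by
  rw [Complex.norm_exp]
  refine Real.exp_le_exp.2 ?_
  have e1 : (-(2 * π * t * Complex.I) * z).re = 2 * π * (t * z.im) := by
    simp [Complex.mul_re, Complex.mul_im]
    ring
  have e2 : t * z.im ≤ n * σ := by
    refine (le_abs_self _).trans ?_
    rw [abs_mul]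
    exact mul_le_mul (abs_le.2 ht) hz (abs_nonneg _) (Nat.cast_nonneg n)
  rw [e1, mul_assoc (2 * π)]
  exact mul_le_mul_of_nonneg_left e2 Real.two_pi_pos.le

/-- Differentiation under the integral sign: `t` stays in a compact interval, so the kernel and its
derivative are bounded locally uniformly in `z`. -/
theorem differentiable_laplace (n : ℕ) {f : ℝ → ℂ} (hf : IntegrableOn f (Icc (-(n : ℝ)) n)) :
    Differentiable ℂ (laplace n f) := by
  intro z₀
  have hcont : ∀ z : ℂ, Continuous fun t : ℝ => Complex.exp (-(2 * π * t * Complex.I) * z) := by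
    intro z
    fun_prop
  have hmeas : ∀ z : ℂ, AEStronglyMeasurable
      (fun t : ℝ => f t * Complex.exp (-(2 * π * t * Complex.I) * z))
      (volume.restrict (Icc (-(n : ℝ)) n)) := fun z =>
    hf.aestronglyMeasurable.mul (hcont z).aestronglyMeasurable
  have hderiv := hasDerivAt_integral_of_dominated_loc_of_deriv_le
    (μ := volume.restrict (Icc (-(n : ℝ)) n)) (𝕜 := ℂ)
    (F := fun z t => f t * Complex.exp (-(2 * π * t * Complex.I) * z))
    (F' := fun z t => f t * (Complex.exp (-(2 * π * t * Complex.I) * z) *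
      -(2 * π * t * Complex.I))) (x₀ := z₀)
    (bound := fun t => ‖f t‖ * (Real.exp (2 * π * n * (|z₀.im| + 1)) * (2 * π * n)))
    (Metric.ball_mem_nhds z₀ one_pos) (Eventually.of_forall hmeas) ?_ ?_ ?_ ?_ ?_
  · exact hderiv.2.differentiableAt
  · refine hf.mul_bdd (c := Real.exp (2 * π * n * |z₀.im|)) (hcont z₀).aestronglyMeasurable ?_
    filter_upwards [ae_restrict_mem measurableSet_Icc] with t ht
    exact norm_exp_neg_two_pi_mul_le ht le_rfl
  · refine hf.aestronglyMeasurable.mul (Continuous.aestronglyMeasurable ?_)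
    fun_prop
  · filter_upwards [ae_restrict_mem measurableSet_Icc] with t ht z hz
    rw [norm_mul, norm_mul]
    have hz' : |z.im| ≤ |z₀.im| + 1 := by
      have e1 : |(z - z₀).im| ≤ ‖z - z₀‖ := Complex.abs_im_le_norm _
      rw [mem_ball_iff_norm] at hz
      rw [Complex.sub_im] at e1
      have := abs_sub_abs_le_abs_sub z.im z₀.im
      linarith
    refine mul_le_mul_of_nonneg_left (mul_le_mul (norm_exp_neg_two_pi_mul_le ht hz') ?_
      (norm_nonneg _) (Real.exp_pos _).le) (norm_nonneg _)
    have : ‖(-(2 * π * t * Complex.I) : ℂ)‖ = 2 * π * |t| := by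
      simp [abs_of_pos Real.pi_pos]
    rw [this]
    exact mul_le_mul_of_nonneg_left (abs_le.2 ht) Real.two_pi_pos.le
  · exact hf.norm.mul_const _
  · refine Eventually.of_forall fun t z _ => ?_
    have h1 : HasDerivAt (fun z : ℂ => -(2 * π * t * Complex.I) * z) (-(2 * π * t * Complex.I)) z := by
      simpa using (hasDerivAt_id z).const_mul (-(2 * π * t * Complex.I) : ℂ)
    exact h1.cexp.const_mul (f t)

theorem exists_norm_laplace_le (n : ℕ) {f : ℝ → ℂ} (hf : IntegrableOn f (Icc (-(n : ℝ)) n))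
    (σ : ℝ) : ∃ K, ∀ z : ℂ, |z.im| ≤ σ → ‖laplace n f z‖ ≤ K := by
  refine ⟨∫ t in Icc (-(n : ℝ)) n, ‖f t‖ * Real.exp (2 * π * n * σ), fun z hz => ?_⟩
  refine norm_integral_le_of_norm_le (hf.norm.mul_const _) ?_
  filter_upwards [ae_restrict_mem measurableSet_Icc] with t ht
  rw [norm_mul]
  exact mul_le_mul_of_nonneg_left (norm_exp_neg_two_pi_mul_le ht hz) (norm_nonneg _)

/-- In an inner product the first factor is conjugated. This identity rewrites the conjugate so
that, on a horizontal line, it is the restriction of a function holomorphic in the frequency. -/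
theorem conj_laplace (n : ℕ) (f : ℝ → ℂ) (z : ℂ) :
    starRingEnd ℂ (laplace n f z) =
      laplace n (fun t => starRingEnd ℂ (f t)) (-(starRingEnd ℂ z)) := by
  rw [laplace, laplace, ← integral_conj]
  refine integral_congr_ae (Eventually.of_forall fun t => ?_)
  simp only [map_mul, ← Complex.exp_conj, map_neg, Complex.conj_I, Complex.conj_ofReal,
    map_ofNat]
  congr 2
  ring

/-- The function `t ↦ e^{ct} 1_{[-n, n]}(t)`. -/
def expCutoff (c : ℝ) (n : ℕ) : ℝ → ℂ :=
  (Icc (-(n : ℝ)) n).indicator fun t => (Real.exp (c * t) : ℂ)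

theorem memLp_expCutoff (c : ℝ) (n : ℕ) : MemLp (expCutoff c n) ∞ volume := by
  refine memLp_top_of_bound ?_ (Real.exp (|c| * n)) (Eventually.of_forall fun t => ?_)
  · exact ((by fun_prop : Measurable fun t : ℝ => (Real.exp (c * t) : ℂ)).indicator
      measurableSet_Icc).aestronglyMeasurable
  · by_cases ht : t ∈ Icc (-(n : ℝ)) n
    · rw [expCutoff, indicator_of_mem ht, Complex.norm_real, Real.norm_of_nonneg (Real.exp_pos _).le]
      refine Real.exp_le_exp.2 ((le_abs_self _).trans ?_)
      rw [abs_mul]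
      exact mul_le_mul_of_nonneg_left (abs_le.2 ht) (abs_nonneg c)
    · rw [expCutoff, indicator_of_notMem ht, norm_zero]
      exact (Real.exp_pos _).le

/-- The operator `h ↦ e^{ct} 1_{[-n, n]}(t) h(t)` on `L²(ℝ)`. -/
def expTrunc (c : ℝ) (n : ℕ) : L2R →L[ℂ] L2R := mulR (expCutoff c n) (memLp_expCutoff c n)

theorem coeFn_expTrunc (c : ℝ) (n : ℕ) (h : L2R) :
    expTrunc c n h =ᵐ[volume] fun t => expCutoff c n t * h t :=
  coeFn_mulR _ _ h

theorem integrableOn_Icc_coeFn (n : ℕ) (h : L2R) : IntegrableOn h (Icc (-(n : ℝ)) n) :=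
  ((Lp.memLp h).locallyIntegrable (by norm_num)).integrableOn_isCompact isCompact_Icc

theorem expCutoff_mul (c : ℝ) (n : ℕ) (h : ℝ → ℂ) :
    (fun t => expCutoff c n t * h t) =
      (Icc (-(n : ℝ)) n).indicator fun t => (Real.exp (c * t) : ℂ) * h t := by
  funext t
  by_cases ht : t ∈ Icc (-(n : ℝ)) n
  · rw [expCutoff, indicator_of_mem ht, indicator_of_mem ht]
  · rw [expCutoff, indicator_of_notMem ht, indicator_of_notMem ht, zero_mul]

theorem integrable_expTrunc (c : ℝ) (n : ℕ) (h : L2R) : Integrable (expTrunc c n h) := by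
  rw [integrable_congr (coeFn_expTrunc c n h), expCutoff_mul, integrable_indicator_iff measurableSet_Icc]
  exact (integrableOn_Icc_coeFn n h).continuousOn_mul (by fun_prop) isCompact_Icc

/-- A real exponential `e^{ct}` is absorbed in the kernel as the imaginary frequency shift `c/(2π)`.
-/
theorem fourierL2_expTrunc (c : ℝ) (n : ℕ) (h : L2R) :
    fourierL2 (expTrunc c n h) =ᵐ[volume]
      fun ξ : ℝ => laplace n h (ξ + (c / (2 * π) : ℝ) * Complex.I) := by
  filter_upwards [coeFn_fourierL2_of_integrable _ (integrable_expTrunc c n h)] with ξ e1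
  rw [e1, Real.fourier_congr_ae (coeFn_expTrunc c n h), Real.fourier_eq', laplace,
    ← integral_indicator measurableSet_Icc]
  refine integral_congr_ae (Eventually.of_forall fun t => ?_)
  have e2 := congrFun (expCutoff_mul c n h) t
  simp only at e2 ⊢
  rw [e2]
  by_cases ht : t ∈ Icc (-(n : ℝ)) n
  · rw [indicator_of_mem ht, indicator_of_mem ht, Complex.ofReal_exp, smul_eq_mul, ← mul_assoc,
      ← Complex.exp_add, mul_comm]
    congr 2
    have hpi : (π : ℂ) ≠ 0 := by exact_mod_cast Real.pi_pos.ne'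
    simp only [RCLike.inner_apply, conj_trivial]
    push_cast
    field_simp
    ring_nf
    rw [Complex.I_sq]
    ring
  · rw [indicator_of_notMem ht, indicator_of_notMem ht, smul_zero]

/-- Conjugating the multiplier `M` by the weight `e^{-2πσt}` yields the multiplier `M(· - iσ)`. -/
theorem inner_expTrunc_multiplierR {M : ℂ → ℂ} {σ B : ℝ} (hσ : 0 ≤ σ)
    (hd : ∀ z : ℂ, -σ ≤ z.im → z.im ≤ 0 → DifferentiableAt ℂ M z)
    (hb : ∀ z : ℂ, -σ ≤ z.im → z.im ≤ 0 → ‖M z‖ ≤ B)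
    (hm : MemLp (fun ξ : ℝ => M ξ) ∞ volume)
    (hm' : MemLp (fun ξ : ℝ => M (ξ - σ * Complex.I)) ∞ volume) (m n : ℕ) (φ h : L2R) :
    inner ℂ (expTrunc (-(2 * π * σ)) m φ) (multiplierR _ hm (expTrunc 0 n h)) =
      inner ℂ (expTrunc 0 m φ) (multiplierR _ hm' (expTrunc (-(2 * π * σ)) n h)) := by
  set Φ := laplace m fun t => starRingEnd ℂ (φ t) with hΦ
  set H := laplace n h with hH
  have hφi : IntegrableOn (fun t => starRingEnd ℂ (φ t)) (Icc (-(m : ℝ)) m) :=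
    (Complex.conjCLE : ℂ →L[ℝ] ℂ).integrable_comp (integrableOn_Icc_coeFn m φ)
  -- One holomorphic function carries both inner products: on `ℝ` the shift by `iσ` puts the weight
  -- on `φ`, while on `Im z = -σ` it cancels in `Φ` and the weight appears on `h`. The identity is
  -- then the contour shift for `G`.
  set G : ℂ → ℂ := fun z => Φ (-(z + σ * Complex.I)) * (M z * H z) with hG
  have hpi := Real.pi_pos.ne'
  have ec : -(2 * π * σ) / (2 * π) = -σ := by field_simp
  have e0 : (fun ξ => inner ℂ (fourierL2 (expTrunc (-(2 * π * σ)) m φ) ξ)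
      (fourierL2 (multiplierR _ hm (expTrunc 0 n h)) ξ)) =ᵐ[volume] fun ξ : ℝ => G ξ := by
    filter_upwards [fourierL2_expTrunc (-(2 * π * σ)) m φ, fourierL2_expTrunc 0 n h,
      fourierL2_multiplierR _ hm (expTrunc 0 n h)] with ξ h1 h2 h3
    rw [h3, h2, h1, RCLike.inner_apply, conj_laplace, ec, hG, mul_comm]
    simp [hΦ, hH]
  have e1 : (fun ξ => inner ℂ (fourierL2 (expTrunc 0 m φ) ξ)
      (fourierL2 (multiplierR _ hm' (expTrunc (-(2 * π * σ)) n h)) ξ)) =ᵐ[volume]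
      fun ξ : ℝ => G (ξ - σ * Complex.I) := by
    filter_upwards [fourierL2_expTrunc (-(2 * π * σ)) n h, fourierL2_expTrunc 0 m φ,
      fourierL2_multiplierR _ hm' (expTrunc (-(2 * π * σ)) n h)] with ξ h1 h2 h3
    rw [h3, h2, h1, RCLike.inner_apply, conj_laplace, ec, hG, mul_comm]
    simp [hΦ, hH, sub_eq_add_neg]
  rw [← fourierL2.inner_map_map (expTrunc (-(2 * π * σ)) m φ),
    ← fourierL2.inner_map_map (expTrunc 0 m φ), L2.inner_def, L2.inner_def,
    integral_congr_ae e0, integral_congr_ae e1]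
  -- These bounds depend on the truncations, but serve only to justify the contour shift and do not
  -- enter the identity.
  obtain ⟨K₁, hK₁⟩ := exists_norm_laplace_le m hφi σ
  obtain ⟨K₂, hK₂⟩ := exists_norm_laplace_le n (integrableOn_Icc_coeFn n h) σ
  refine integral_eq_integral_sub_mul_I (K := K₁ * (B * K₂)) hσ ?_ ?_
    ((integrable_congr e0).1 (L2.integrable_inner _ _))
    ((integrable_congr e1).1 (L2.integrable_inner _ _))
  · intro z hz1 hz2
    have hdΦ := differentiable_laplace m hφi
    have hdH := differentiable_laplace n (integrableOn_Icc_coeFn n h)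
    exact (hdΦ.comp (by fun_prop : Differentiable ℂ fun z : ℂ => -(z + σ * Complex.I))).differentiableAt.mul
      ((hd z hz1 hz2).mul hdH.differentiableAt)
  · intro z hz1 hz2
    have h1 : ‖Φ (-(z + σ * Complex.I))‖ ≤ K₁ := by
      refine hK₁ _ ?_
      rw [abs_le]
      simp only [Complex.neg_im, Complex.add_im, Complex.mul_im, Complex.ofReal_re,
        Complex.I_im, Complex.ofReal_im, Complex.I_re, mul_one, mul_zero, add_zero]
      constructor <;> linarith
    have h2 : ‖H z‖ ≤ K₂ := hK₂ _ (abs_le.2 ⟨hz1, by linarith⟩)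
    have h3 := hb z hz1 hz2
    rw [norm_mul, norm_mul]
    exact mul_le_mul h1 (mul_le_mul h3 h2 (norm_nonneg _) ((norm_nonneg _).trans h3))
      (by positivity) ((norm_nonneg _).trans h1)

theorem enorm_expTrunc_sq (s : ℝ) (n : ℕ) (h : L2R) :
    ‖expTrunc (-s) n h‖ₑ ^ 2 =
      ∫⁻ t in Icc (-(n : ℝ)) n, ENNReal.ofReal (Real.exp (-(2 * s * t))) * ‖h t‖ₑ ^ 2 := by
  rw [← lintegral_enorm_sq, ← lintegral_indicator measurableSet_Icc]
  refine lintegral_congr_ae ?_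
  filter_upwards [coeFn_expTrunc (-s) n h] with t e
  rw [e]
  have e2 := congrFun (expCutoff_mul (-s) n h) t
  rw [e2]
  by_cases ht : t ∈ Icc (-(n : ℝ)) n
  · rw [indicator_of_mem ht, indicator_of_mem ht, enorm_mul, mul_pow, enorm_ofReal_exp_sq]
    congr 4
    ring
  · rw [indicator_of_notMem ht, indicator_of_notMem ht]
    simp

theorem enorm_expTrunc_sq_le (s : ℝ) (n : ℕ) (h : L2R) :
    ‖expTrunc (-s) n h‖ₑ ^ 2 ≤ logNorm s h := by
  rw [enorm_expTrunc_sq]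
  exact setLIntegral_le_lintegral _ _

theorem aecover_Icc_natCast : AECover (volume : Measure ℝ) atTop fun n : ℕ => Icc (-(n : ℝ)) n :=
  aecover_Icc (tendsto_neg_atTop_atBot.comp tendsto_natCast_atTop_atTop) tendsto_natCast_atTop_atTop

theorem tendsto_enorm_expTrunc_sq (s : ℝ) (h : L2R) :
    Tendsto (fun n : ℕ => ‖expTrunc (-s) n h‖ₑ ^ 2) atTop (nhds (logNorm s h)) := by
  simp only [enorm_expTrunc_sq]
  have hh := measurable_coeFn h
  exact aecover_Icc_natCast.lintegral_tendsto_of_countably_generated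
    (by fun_prop : Measurable fun t => ENNReal.ofReal (Real.exp (-(2 * s * t))) *
      ‖h t‖ₑ ^ 2).aemeasurable

theorem conj_expCutoff (c : ℝ) (n : ℕ) (t : ℝ) :
    starRingEnd ℂ (expCutoff c n t) = expCutoff c n t := by
  by_cases ht : t ∈ Icc (-(n : ℝ)) n
  · rw [expCutoff, indicator_of_mem ht, Complex.conj_ofReal]
  · rw [expCutoff, indicator_of_notMem ht, map_zero]

theorem inner_expTrunc_left (c : ℝ) (n : ℕ) (φ f : L2R) :
    inner ℂ (expTrunc c n φ) f = inner ℂ φ (expTrunc c n f) := by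
  rw [L2.inner_def, L2.inner_def]
  refine integral_congr_ae ?_
  filter_upwards [coeFn_expTrunc c n φ, coeFn_expTrunc c n f] with t e1 e2
  rw [e1, e2, RCLike.inner_apply, RCLike.inner_apply, map_mul, conj_expCutoff]
  ring

theorem expTrunc_zero_expTrunc (c : ℝ) (n : ℕ) (f : L2R) :
    expTrunc 0 n (expTrunc c n f) = expTrunc c n f := by
  refine Lp.ext ?_
  filter_upwards [coeFn_expTrunc 0 n (expTrunc c n f), coeFn_expTrunc c n f] with t e1 e2
  rw [e1, e2]
  by_cases ht : t ∈ Icc (-(n : ℝ)) n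
  · simp [expCutoff, ht]
  · simp [expCutoff, ht]

/-- With `c = 0` the truncation is an orthogonal projection, so `‖Ph - h‖² = ‖h‖² - ‖Ph‖²` and
convergence of the norms is enough. -/
theorem tendsto_expTrunc_zero (h : L2R) :
    Tendsto (fun n : ℕ => expTrunc 0 n h) atTop (nhds h) := by
  rw [tendsto_iff_norm_sub_tendsto_zero]
  have hsq : ∀ n : ℕ, ‖expTrunc 0 n h - h‖ ^ 2 = ‖h‖ ^ 2 - ‖expTrunc 0 n h‖ ^ 2 := by
    intro n
    have h1 : inner ℂ (expTrunc 0 n h) h = inner ℂ (expTrunc 0 n h) (expTrunc 0 n h) := by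
      conv_lhs => rw [← expTrunc_zero_expTrunc, inner_expTrunc_left]
    rw [norm_sub_sq (𝕜 := ℂ), h1, inner_self_eq_norm_sq]
    ring
  have h0 : logNorm 0 h = ‖h‖ₑ ^ 2 := by simp [logNorm, lintegral_enorm_sq]
  have h1 : Tendsto (fun n : ℕ => ‖expTrunc 0 n h‖ ^ 2) atTop (nhds (‖h‖ ^ 2)) := by
    have h2 := tendsto_enorm_expTrunc_sq 0 h
    rw [h0, neg_zero] at h2
    simpa [Function.comp_def] using (ENNReal.continuousAt_toReal (by simp)).tendsto.comp h2
  have h3 : Tendsto (fun n : ℕ => ‖expTrunc 0 n h - h‖ ^ 2) atTop (nhds 0) := by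
    simp only [hsq]
    have h4 := h1.const_sub (‖h‖ ^ 2)
    rwa [sub_self] at h4
  simpa using h3.sqrt

/-- A Fourier multiplier with a bounded holomorphic extension to the strip `-σ ≤ Im z ≤ 0` is
bounded on `L²(ℝ, e^{-4πσt} dt)`. -/
theorem logNorm_multiplierR_le {M : ℂ → ℂ} {σ B : ℝ} (hσ : 0 ≤ σ) (hB : 0 < B)
    (hd : ∀ z : ℂ, -σ ≤ z.im → z.im ≤ 0 → DifferentiableAt ℂ M z)
    (hb : ∀ z : ℂ, -σ ≤ z.im → z.im ≤ 0 → ‖M z‖ ≤ B)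
    (hm : MemLp (fun ξ : ℝ => M ξ) ∞ volume)
    (hm' : MemLp (fun ξ : ℝ => M (ξ - σ * Complex.I)) ∞ volume) (h : L2R) :
    logNorm (2 * π * σ) (multiplierR _ hm h) ≤ ENNReal.ofReal (B ^ 2) * logNorm (2 * π * σ) h := by
  set s := 2 * π * σ with hs
  rcases eq_or_ne (logNorm s h) ∞ with htop | htop
  · rw [htop, ENNReal.mul_top (ENNReal.ofReal_pos.2 (by positivity)).ne']
    exact le_top
  set N := Real.sqrt (logNorm s h).toReal with hN
  have hNn : ∀ n, ‖expTrunc (-s) n h‖ ≤ N := by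
    intro n
    refine Real.le_sqrt_of_sq_le ?_
    have h1 := ENNReal.toReal_mono htop (enorm_expTrunc_sq_le s n h)
    simpa using h1
  -- Duality: test against `φ`, the weighted and truncated output itself. Moving the weight across
  -- the multiplier gives `‖φ‖² ≤ ‖φ‖ B N`, uniformly in both truncations.
  have hcut : ∀ m n, ‖expTrunc (-s) m (multiplierR _ hm (expTrunc 0 n h))‖ ≤ B * N := by
    intro m n
    set f := multiplierR _ hm (expTrunc 0 n h) with hf
    set φ := expTrunc (-s) m f with hφ
    have h1 := inner_expTrunc_multiplierR hσ hd hb hm hm' m n φ h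
    have h2 : inner ℂ (expTrunc (-s) m φ) f = inner ℂ φ φ := inner_expTrunc_left _ _ _ _
    have h3 : expTrunc 0 m φ = φ := expTrunc_zero_expTrunc _ _ _
    rw [← hs, ← hf, h2, h3, inner_self_eq_norm_sq_to_K] at h1
    have h4 : ‖φ‖ ^ 2 ≤ ‖φ‖ * (B * N) := by
      have h5 := norm_inner_le_norm (𝕜 := ℂ) φ (multiplierR _ hm' (expTrunc (-s) n h))
      rw [← h1] at h5
      have h6 : ‖((‖φ‖ : ℂ)) ^ 2‖ = ‖φ‖ ^ 2 := by simp
      have h7 := norm_multiplierR_le _ hm' (fun ξ : ℝ => hb (ξ - σ * Complex.I) (by simp) (by simpa using hσ))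
        (expTrunc (-s) n h)
      refine (h6.symm.le.trans h5).trans (mul_le_mul_of_nonneg_left (h7.trans ?_) (norm_nonneg _))
      exact mul_le_mul_of_nonneg_left (hNn n) hB.le
    rcases (norm_nonneg φ).eq_or_lt with h0 | h0
    · rw [← h0]
      positivity
    · rw [pow_two] at h4
      exact le_of_mul_le_mul_left h4 h0
  -- The truncation of the input is removed by continuity on `L²`, since the weight cut off at `m`
  -- is bounded; that of the output goes last, by convergence of the truncated norms.
  have hcut' : ∀ m, ‖expTrunc (-s) m (multiplierR _ hm h)‖ ≤ B * N := by
    intro m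
    have hc : Continuous fun k : L2R => ‖expTrunc (-s) m (multiplierR _ hm k)‖ := by fun_prop
    have ht := (hc.tendsto h).comp (tendsto_expTrunc_zero h)
    exact le_of_tendsto' ht (hcut m)
  refine le_of_tendsto' (tendsto_enorm_expTrunc_sq s _) fun m => ?_
  rw [← ofReal_norm, ← ENNReal.ofReal_pow (norm_nonneg _), ← ENNReal.ofReal_toReal htop,
    ← ENNReal.ofReal_mul (by positivity)]
  refine ENNReal.ofReal_le_ofReal ((pow_le_pow_left₀ (norm_nonneg _) (hcut' m) 2).trans (le_of_eq ?_))
  rw [mul_pow, hN, Real.sq_sqrt ENNReal.toReal_nonneg]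

/-! ### The symbol on the strip -/

/-- With `r = e^{Re w}` and `c = cos θ`, one has `|1 + e^w|² ≥ 1 + 2rc + r² = (1+c)/2 · (1+r)² +
(1-c)/2 · (1-r)²`, and `(1+r)² ≥ 1`. -/
theorem le_norm_one_add_exp_sq {θ : ℝ} (hθ : θ < π) {w : ℂ} (hw : |w.im| ≤ θ) :
    (1 + Real.cos θ) / 2 ≤ ‖1 + Complex.exp w‖ ^ 2 := by
  have hc : Real.cos θ ≤ Real.cos w.im := by
    rw [← Real.cos_abs w.im]
    exact Real.cos_le_cos_of_nonneg_of_le_pi (abs_nonneg _) hθ.le hw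
  have h1 : Real.cos θ ≤ 1 := Real.cos_le_one θ
  have h2 : -1 ≤ Real.cos θ := Real.neg_one_le_cos θ
  have hr := Real.exp_pos w.re
  set r := Real.exp w.re with hrdef
  have h3 : ‖1 + Complex.exp w‖ ^ 2 = 1 + 2 * r * Real.cos w.im + r ^ 2 := by
    rw [Complex.sq_norm, Complex.normSq_apply, Complex.add_re, Complex.add_im, Complex.exp_re,
      Complex.exp_im, Complex.one_re, Complex.one_im, ← hrdef]
    linear_combination r ^ 2 * Real.sin_sq_add_cos_sq w.im
  rw [h3]
  nlinarith [mul_le_mul_of_nonneg_left hc hr.le, sq_nonneg (1 - r),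
    mul_nonneg (sub_nonneg.2 h1) (sq_nonneg (1 - r))]

/-- The holomorphic extension of `η ↦ M_a(2πη, j)`. -/
def symbolExt (a : ℝ) (j : ℤ) (z : ℂ) : ℂ :=
  Real.exp (a / 4) / (1 + Complex.exp (-(2 * a * (2 * π * z - j / 2 - 1 / 4))))

/-- The identity `e^y / (2 cosh y) = 1 / (1 + e^{-2y})`; the factor `2π` converts between the two
normalizations of frequency. -/
theorem symbolExt_ofReal (a : ℝ) (j : ℤ) (η : ℝ) :
    symbolExt a j η = (MSymbol a (2 * π * η) j : ℂ) := by
  have h : ∀ x : ℝ, mSymbol a x = 1 / (1 + Real.exp (-(2 * a * x))) := by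
    intro x
    have h1 := Real.exp_pos (a * x)
    have h2 : Real.exp (-(2 * a * x)) = Real.exp (-(a * x)) / Real.exp (a * x) := by
      rw [← Real.exp_sub]
      congr 1
      ring
    have h3 := Real.exp_pos (-(a * x))
    rw [mSymbol, Real.cosh_eq, h2]
    field_simp
  rw [MSymbol, h, symbolExt]
  push_cast
  rw [mul_one_div]

/-- The shift by `j/2 + 1/4` is real, so it drops out of the imaginary part. This is the source of
uniformity in `j`. -/
theorem im_symbolExt_exponent (a : ℝ) (j : ℤ) (z : ℂ) :
    (-(2 * a * (2 * π * z - j / 2 - 1 / 4)) : ℂ).im = -(4 * π * a * z.im) := by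
  have : (-(2 * a * (2 * π * z - j / 2 - 1 / 4)) : ℂ) =
      ((4 * π * a : ℝ) : ℂ) * -z + ((2 * a * (j / 2 + 1 / 4) : ℝ) : ℂ) := by
    push_cast
    ring
  rw [this, Complex.add_im, Complex.ofReal_im, Complex.im_ofReal_mul, Complex.neg_im]
  ring

theorem abs_im_symbolExt_exponent_le {a σ : ℝ} (j : ℤ) {z : ℂ} (hz : |z.im| ≤ σ) :
    |(-(2 * a * (2 * π * z - j / 2 - 1 / 4)) : ℂ).im| ≤ 4 * π * |a| * σ := by
  rw [im_symbolExt_exponent, abs_neg, abs_mul, abs_mul, abs_of_pos (by positivity : 0 < 4 * π)]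
  gcongr

theorem one_add_cos_pos {θ : ℝ} (h0 : 0 ≤ θ) (hθ : θ < π) : 0 < (1 + Real.cos θ) / 2 := by
  have : Real.cos π < Real.cos θ := Real.cos_lt_cos_of_nonneg_of_le_pi h0 le_rfl hθ
  rw [Real.cos_pi] at this
  linarith

theorem differentiableAt_symbolExt {a σ : ℝ} (hσ : 0 ≤ σ) (ha : 4 * π * |a| * σ < π) (j : ℤ) {z : ℂ}
    (hz : |z.im| ≤ σ) : DifferentiableAt ℂ (symbolExt a j) z := by
  have h1 := le_norm_one_add_exp_sq ha (abs_im_symbolExt_exponent_le (a := a) j hz)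
  have h2 := (one_add_cos_pos (by positivity) ha).trans_le h1
  have h3 : 1 + Complex.exp (-(2 * a * (2 * π * z - j / 2 - 1 / 4))) ≠ 0 := by
    intro h
    rw [h] at h2
    simp at h2
  unfold symbolExt
  exact (differentiableAt_const _).div (by fun_prop) h3

theorem norm_symbolExt_le {a σ : ℝ} (hσ : 0 ≤ σ) (ha : 4 * π * |a| * σ < π) (j : ℤ) {z : ℂ}
    (hz : |z.im| ≤ σ) :
    ‖symbolExt a j z‖ ≤ Real.exp (a / 4) / √((1 + Real.cos (4 * π * |a| * σ)) / 2) := by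
  have h1 := le_norm_one_add_exp_sq ha (abs_im_symbolExt_exponent_le (a := a) j hz)
  have h2 := one_add_cos_pos (by positivity) ha
  rw [symbolExt, norm_div, Complex.norm_real, Real.norm_of_nonneg (Real.exp_pos _).le]
  refine div_le_div_of_nonneg_left (Real.exp_pos _).le (Real.sqrt_pos.2 h2) ?_
  exact Real.sqrt_le_iff.2 ⟨norm_nonneg _, h1⟩

theorem measurable_symbolExt (a : ℝ) (j : ℤ) : Measurable (symbolExt a j) := by
  unfold symbolExt
  fun_prop

theorem memLp_symbolExt_line {a σ : ℝ} (hσ : 0 ≤ σ) (ha : 4 * π * |a| * σ < π) (j : ℤ) :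
    MemLp (fun ξ : ℝ => symbolExt a j (ξ - σ * Complex.I)) ∞ volume := by
  have hm := measurable_symbolExt a j
  refine memLp_top_of_bound (by fun_prop : Measurable _).aestronglyMeasurable _
    (Eventually.of_forall fun ξ => norm_symbolExt_le hσ ha j ?_)
  simp [abs_of_nonneg hσ]

theorem norm_symbolExt_ofReal_le (a : ℝ) (j : ℤ) (ξ : ℝ) : ‖symbolExt a j ξ‖ ≤ Real.exp (a / 4) := by
  rw [symbolExt_ofReal, Complex.norm_real, MSymbol, norm_mul,
    Real.norm_of_nonneg (Real.exp_pos _).le, Real.norm_of_nonneg (mSymbol_nonneg _ _)]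
  exact mul_le_of_le_one_right (Real.exp_pos _).le (mSymbol_le_one _ _)

theorem memLp_symbolExt (a : ℝ) (j : ℤ) : MemLp (fun ξ : ℝ => symbolExt a j ξ) ∞ volume := by
  have hm := measurable_symbolExt a j
  exact memLp_top_of_bound (by fun_prop : Measurable _).aestronglyMeasurable _
    (Eventually.of_forall fun ξ => norm_symbolExt_ofReal_le a j ξ)

/-! ### Estimates for a single mode -/

/-- The action of `Q_a` on the `j`-th Fourier mode in `θ`. -/
def modeOp (a : ℝ) (j : ℤ) : L2R →L[ℂ] L2R :=
  ofLog.toContinuousLinearMap ∘L multiplierR _ (memLp_symbolExt a j) ∘L toLog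

theorem norm_modeOp_le (a : ℝ) (j : ℤ) (g : L2R) :
    ‖modeOp a j g‖ ≤ Real.exp (a / 4) * ‖toLog‖ * ‖g‖ := by
  have h : ‖modeOp a j g‖ = ‖multiplierR _ (memLp_symbolExt a j) (toLog g)‖ := ofLog.norm_map _
  rw [h, mul_assoc]
  exact (norm_multiplierR_le _ _ (norm_symbolExt_ofReal_le a j) _).trans
    (mul_le_mul_of_nonneg_left (toLog.le_opNorm g) (Real.exp_pos _).le)

theorem exists_lintegral_rpow_fourierL2_modeOp_le {a s : ℝ} (hs₀ : 0 < s) (hs₁ : s < 1 / 2)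
    (ha : 2 * |a| * s < π) :
    ∃ C : ℝ≥0∞, C ≠ ∞ ∧ ∀ (j : ℤ) (g : L2R),
      ∫⁻ η, ENNReal.ofReal (|η| ^ (2 * s)) * ‖fourierL2 (modeOp a j g) η‖ₑ ^ 2 ≤
        C * ∫⁻ η, ENNReal.ofReal (|η| ^ (2 * s)) * ‖fourierL2 g η‖ₑ ^ 2 := by
  obtain ⟨C, hC, hle⟩ := exists_gagliardo_ofLog_le hs₀ hs₁
  -- The weight `e^{-2st}` equals `e^{-4πσt}`, so this is the width of the strip; the condition
  -- `4π|a|σ < π` becomes `2|a|s < π`.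
  set σ := s / (2 * π) with hσ
  have hpi := Real.pi_pos
  have hσ0 : 0 ≤ σ := by positivity
  have hsσ : 2 * π * σ = s := by rw [hσ]; field_simp
  have haσ : 4 * π * |a| * σ < π := by
    have : 4 * π * |a| * σ = 2 * |a| * s := by rw [← hsσ]; ring
    rwa [this]
  set B := Real.exp (a / 4) / √((1 + Real.cos (4 * π * |a| * σ)) / 2) with hB
  have hB0 : 0 < B :=
    div_pos (Real.exp_pos _) (Real.sqrt_pos.2 (one_add_cos_pos (by positivity) haσ))
  have him : ∀ z : ℂ, -σ ≤ z.im → z.im ≤ 0 → |z.im| ≤ σ := fun z h1 h2 =>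
    abs_le.2 ⟨h1, h2.trans hσ0⟩
  refine ⟨C * ENNReal.ofReal (B ^ 2), ENNReal.mul_ne_top hC ENNReal.ofReal_ne_top, fun j g => ?_⟩
  have hT : ∀ h : L2R, logNorm s (multiplierR _ (memLp_symbolExt a j) h) ≤
      ENNReal.ofReal (B ^ 2) * logNorm s h := by
    intro h
    have := logNorm_multiplierR_le (M := symbolExt a j) hσ0 hB0
      (fun z h1 h2 => differentiableAt_symbolExt hσ0 haσ j (him z h1 h2))
      (fun z h1 h2 => norm_symbolExt_le hσ0 haσ j (him z h1 h2))
      (memLp_symbolExt a j) (memLp_symbolExt_line hσ0 haσ j) h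
    rwa [hsσ] at this
  have h1 := hle _ ENNReal.ofReal_ne_top (multiplierR _ (memLp_symbolExt a j))
    (fun v h => multiplierR_translate _ _ v h) hT g
  rw [show ofLog (multiplierR _ (memLp_symbolExt a j) (toLog g)) = modeOp a j g from rfl,
    gagliardo_eq, gagliardo_eq, mul_left_comm] at h1
  exact (ENNReal.mul_le_mul_iff_right (gagliardoSymbol_one_ne_zero s)
    (gagliardoSymbol_one_ne_top hs₀ (by linarith))).1 h1

/-- The weight `(1 + (2πη)² + j²)^s`. -/
def modeWeight (s : ℝ) (j : ℤ) (η : ℝ) : ℝ≥0∞ :=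
  ENNReal.ofReal ((1 + (2 * π * η) ^ 2 + (j : ℝ) ^ 2) ^ s)

theorem lintegral_enorm_fourierL2_sq (g : L2R) : ∫⁻ η, ‖fourierL2 g η‖ₑ ^ 2 = ‖g‖ₑ ^ 2 := by
  rw [lintegral_enorm_sq, ← ofReal_norm, LinearIsometryEquiv.norm_map, ofReal_norm]

/-- The weight is at most `(1 + j²)^s + |2πη|^{2s}`, by subadditivity of `t ↦ t^s`, and dominates
each summand. The two pieces are bounded by the `L²` estimate and the Gagliardo estimate, both
uniform in `j`. -/
theorem exists_lintegral_modeWeight_fourierL2_modeOp_le {a s : ℝ} (hs₀ : 0 ≤ s) (hs₁ : s < 1 / 2)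
    (ha : 2 * |a| * s < π) :
    ∃ C : ℝ≥0∞, C ≠ ∞ ∧ ∀ (j : ℤ) (g : L2R),
      ∫⁻ η, modeWeight s j η * ‖fourierL2 (modeOp a j g) η‖ₑ ^ 2 ≤
        C * ∫⁻ η, modeWeight s j η * ‖fourierL2 g η‖ₑ ^ 2 := by
  set D := ENNReal.ofReal ((Real.exp (a / 4) * ‖toLog‖) ^ 2) with hD
  have hL2 : ∀ (j : ℤ) (g : L2R), ∫⁻ η, ‖fourierL2 (modeOp a j g) η‖ₑ ^ 2 ≤
      D * ∫⁻ η, ‖fourierL2 g η‖ₑ ^ 2 := by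
    intro j g
    rw [lintegral_enorm_fourierL2_sq, lintegral_enorm_fourierL2_sq, ← ofReal_norm, ← ofReal_norm,
      ← ENNReal.ofReal_pow (norm_nonneg _), ← ENNReal.ofReal_pow (norm_nonneg _), hD,
      ← ENNReal.ofReal_mul (by positivity), ← mul_pow]
    exact ENNReal.ofReal_le_ofReal (pow_le_pow_left₀ (norm_nonneg _) (norm_modeOp_le a j g) 2)
  -- For `s = 0` the weight is `1` and the `L²` bound suffices; the Gagliardo description needs `s >
  -- 0`.
  rcases hs₀.eq_or_lt with rfl | hs
  · refine ⟨D, ENNReal.ofReal_ne_top, fun j g => ?_⟩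
    simpa [modeWeight] using hL2 j g
  obtain ⟨C, hC, hle⟩ := exists_lintegral_rpow_fourierL2_modeOp_le hs hs₁ ha
  refine ⟨D + C, ENNReal.add_ne_top.2 ⟨ENNReal.ofReal_ne_top, hC⟩, fun j g => ?_⟩
  set A := ENNReal.ofReal ((1 + (j : ℝ) ^ 2) ^ s) with hA
  set P := ENNReal.ofReal ((2 * π) ^ (2 * s)) with hP
  have hsplit : ∀ η : ℝ, P * ENNReal.ofReal (|η| ^ (2 * s)) =
      ENNReal.ofReal (((2 * π * η) ^ 2) ^ s) := by
    intro η
    rw [hP, ← ENNReal.ofReal_mul (by positivity),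
      ← Real.mul_rpow Real.two_pi_pos.le (abs_nonneg _)]
    congr 1
    rw [Real.rpow_mul (by positivity), Real.rpow_two, mul_pow, sq_abs, ← mul_pow]
  have hup : ∀ η, modeWeight s j η ≤ A + P * ENNReal.ofReal (|η| ^ (2 * s)) := by
    intro η
    rw [hsplit, hA, ← ENNReal.ofReal_add (by positivity) (by positivity)]
    refine ENNReal.ofReal_le_ofReal ?_
    rw [add_right_comm]
    exact Real.rpow_add_le_add_rpow (by positivity) (by positivity) hs.le (by linarith)
  have hlo1 : ∀ η, A ≤ modeWeight s j η := fun η =>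
    ENNReal.ofReal_le_ofReal (Real.rpow_le_rpow (by positivity)
      (by linarith [sq_nonneg (2 * π * η)]) hs.le)
  have hlo2 : ∀ η, P * ENNReal.ofReal (|η| ^ (2 * s)) ≤ modeWeight s j η := fun η => by
    rw [hsplit]
    exact ENNReal.ofReal_le_ofReal (Real.rpow_le_rpow (by positivity)
      (by linarith [sq_nonneg (j : ℝ)]) hs.le)
  have hm : ∀ k : L2R, Measurable (fourierL2 k : ℝ → ℂ) := fun k => measurable_coeFn _
  have hA' : ∀ k : L2R, ∫⁻ η, A * ‖fourierL2 k η‖ₑ ^ 2 = A * ∫⁻ η, ‖fourierL2 k η‖ₑ ^ 2 :=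
    fun k => lintegral_const_mul' _ _ ENNReal.ofReal_ne_top
  have hP' : ∀ k : L2R, ∫⁻ η, P * (ENNReal.ofReal (|η| ^ (2 * s)) * ‖fourierL2 k η‖ₑ ^ 2) =
      P * ∫⁻ η, ENNReal.ofReal (|η| ^ (2 * s)) * ‖fourierL2 k η‖ₑ ^ 2 :=
    fun k => lintegral_const_mul' _ _ ENNReal.ofReal_ne_top
  have hm' := hm (modeOp a j g)
  calc ∫⁻ η, modeWeight s j η * ‖fourierL2 (modeOp a j g) η‖ₑ ^ 2
      ≤ ∫⁻ η, (A * ‖fourierL2 (modeOp a j g) η‖ₑ ^ 2 +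
          P * (ENNReal.ofReal (|η| ^ (2 * s)) * ‖fourierL2 (modeOp a j g) η‖ₑ ^ 2)) := by
        refine lintegral_mono fun η => ?_
        rw [← mul_assoc, ← add_mul]
        exact mul_le_mul_left (hup η) _
    _ = A * (∫⁻ η, ‖fourierL2 (modeOp a j g) η‖ₑ ^ 2) +
          P * ∫⁻ η, ENNReal.ofReal (|η| ^ (2 * s)) * ‖fourierL2 (modeOp a j g) η‖ₑ ^ 2 := by
        rw [lintegral_add_left ((hm'.enorm.pow_const 2).const_mul A), hA', hP']
    _ ≤ A * (D * ∫⁻ η, ‖fourierL2 g η‖ₑ ^ 2) +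
          P * (C * ∫⁻ η, ENNReal.ofReal (|η| ^ (2 * s)) * ‖fourierL2 g η‖ₑ ^ 2) := by
        gcongr
        · exact hL2 j g
        · exact hle j g
    _ = D * (∫⁻ η, A * ‖fourierL2 g η‖ₑ ^ 2) +
          C * ∫⁻ η, P * (ENNReal.ofReal (|η| ^ (2 * s)) * ‖fourierL2 g η‖ₑ ^ 2) := by
        rw [hA', hP']
        ring
    _ ≤ D * (∫⁻ η, modeWeight s j η * ‖fourierL2 g η‖ₑ ^ 2) +
          C * ∫⁻ η, modeWeight s j η * ‖fourierL2 g η‖ₑ ^ 2 := by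
        refine add_le_add (mul_le_mul_right (lintegral_mono fun η => ?_) _)
          (mul_le_mul_right (lintegral_mono fun η => ?_) _)
        · exact mul_le_mul_left (hlo1 η) _
        · rw [← mul_assoc]
          exact mul_le_mul_left (hlo2 η) _
    _ = _ := by rw [add_mul]

/-! ### Decomposition of the operator into Fourier modes -/

theorem fourierR_multiplierR_symbolExt (a : ℝ) (j : ℤ) (h : L2R) :
    fourierR (multiplierR _ (memLp_symbolExt a j) h) =ᵐ[measureFreq]
      fun ξ => (MSymbol a ξ j : ℂ) * fourierR h ξ := by
  filter_upwards [coeFn_fourierR (multiplierR _ (memLp_symbolExt a j) h), coeFn_fourierR h,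
    isL2Weight_toFreq.ae_congr (fourierL2_multiplierR _ (memLp_symbolExt a j) h)] with ξ e1 e2 e3
  rw [one_mul, one_mul, symbolExt_ofReal, mul_div_cancel₀ ξ Real.two_pi_pos.ne'] at e3
  rw [e1, e2, e3]

theorem multiplierOp_tensorRT (a : ℝ) (j : ℤ) (h : L2R) :
    multiplierOp (fun p => (MSymbol a p.1 p.2 : ℂ)) (memLp_MSymbol a) (tensorRT j h) =
      tensorRT j (multiplierR _ (memLp_symbolExt a j) h) := by
  apply fourierRT.injective
  have h0 := fourierRT_tensor j h
  rw [fourierRT_tensor]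
  refine Lp.ext ?_
  filter_upwards [fourierRT_multiplierOp _ (memLp_MSymbol a) (tensorRT j h),
    coeFn_tensorRZ j (fourierR (multiplierR _ (memLp_symbolExt a j) h)),
    coeFn_tensorRZ j (fourierR h),
    Measure.quasiMeasurePreserving_fst.ae_eq (fourierR_multiplierR_symbolExt a j h)]
    with p e1 e2 e3 e4
  simp only [Function.comp_apply] at e4
  rw [e1, e2, h0, e3, e4]
  by_cases hp : p.2 = j
  · rw [if_pos hp, if_pos hp, hp]
  · rw [if_neg hp, if_neg hp, mul_zero]

theorem C2_restrictHalf_tensorRT (j : ℤ) (g : L2R) :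
    C2 (restrictHalf (tensorRT j g)) = tensorRT j (toLog g) := by
  refine Lp.ext ?_
  have h1 : restrictHalf (tensorRT j g) =ᵐ[measureRT.restrict halfStrip]
      fun p => fourier j p.2 * g p.1 :=
    (LpToLpRestrictCLM_coeFn ℂ halfStrip (tensorRT j g)).trans
      (ae_restrict_of_ae (coeFn_tensorRT j g))
  filter_upwards [coeFn_C2 (restrictHalf (tensorRT j g)), isL2Weight_C2.ae_congr h1,
    coeFn_tensorRT j (toLog g), Measure.quasiMeasurePreserving_fst.ae_eq (coeFn_toLog g)]
    with p e1 e2 e3 e4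
  simp only [Function.comp_apply] at e4
  rw [e1, e2, e3, e4]
  ring

theorem C2_symm_eq (g : L2RT) : C2.symm g = isL2Weight_C2inv.isometry g := by
  rw [LinearIsometryEquiv.symm_apply_eq]
  refine Lp.ext ?_
  filter_upwards [coeFn_C2 (isL2Weight_C2inv.isometry g),
    isL2Weight_C2.ae_congr (isL2Weight_C2inv.coeFn_isometry g)] with p h1 h2
  rw [h1, h2]
  simp only [Real.log_exp, Prod.mk.eta]
  rw [← mul_assoc, ← Complex.ofReal_mul, ← Real.exp_add]
  simp

theorem extendHalf_C2_symm_tensorRT (j : ℤ) (k : L2R) :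
    extendHalf (C2.symm (tensorRT j k)) = tensorRT j (ofLog k) := by
  refine Lp.ext ?_
  have h1 : C2.symm (tensorRT j k) =ᵐ[measureRT.restrict halfStrip] fun p =>
      (Real.exp (-(Real.log p.1 / 2)) : ℂ) * (fourier j p.2 * k (Real.log p.1)) := by
    rw [C2_symm_eq]
    exact (isL2Weight_C2inv.coeFn_isometry _).trans
      (isL2Weight_C2inv.ae_congr (coeFn_tensorRT j k))
  have h2 := (ae_restrict_iff' measurableSet_halfStrip).1 h1
  filter_upwards [coeFn_extendHalf (C2.symm (tensorRT j k)), h2, coeFn_tensorRT j (ofLog k),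
    Measure.quasiMeasurePreserving_fst.ae_eq (coeFn_ofLog k)] with p e1 e2 e3 e4
  simp only [Function.comp_apply] at e4
  rw [e1, e3, e4]
  by_cases hp : p ∈ halfStrip
  · rw [indicator_of_mem hp, indicator_of_mem (show p.1 ∈ Ioi (0 : ℝ) from hp.1), e2 hp]
    ring
  · have hp' : p.1 ∉ Ioi (0 : ℝ) := fun h => hp ⟨h, mem_univ _⟩
    rw [indicator_of_notMem hp, indicator_of_notMem hp', mul_zero]

/-- The cutoffs and `𝒞₂` act on `x` alone, and the multiplier acts on `g ⊗ e_j` through its symbol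
at the fixed index `j`. -/
theorem opQ_tensorRT (a : ℝ) (j : ℤ) (g : L2R) :
    opQ a (tensorRT j g) = tensorRT j (modeOp a j g) := by
  change extendHalf (C2.symm (multiplierOp (fun p => (MSymbol a p.1 p.2 : ℂ)) (memLp_MSymbol a)
    (C2 (restrictHalf (tensorRT j g))))) = tensorRT j (ofLog (multiplierR _ _ (toLog g)))
  rw [C2_restrictHalf_tensorRT, multiplierOp_tensorRT, extendHalf_C2_symm_tensorRT]

/-- The `j`-th Fourier mode in `θ` of a function on `ℝ × 𝕋`. -/
def mode (j : ℤ) : L2RT →L[ℂ] L2R :=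
  ContinuousLinearMap.adjoint (tensorRT j).toContinuousLinearMap

theorem inner_mode_right (j : ℤ) (h : L2R) (f : L2RT) :
    inner ℂ h (mode j f) = inner ℂ (tensorRT j h) f :=
  ContinuousLinearMap.adjoint_inner_right _ _ _

theorem mode_tensorRT_self (j : ℤ) (g : L2R) : mode j (tensorRT j g) = g :=
  ext_inner_left ℂ fun h => by rw [inner_mode_right, LinearIsometry.inner_map_map]

theorem mode_tensorRT_of_ne {i j : ℤ} (hij : j ≠ i) (g : L2R) : mode j (tensorRT i g) = 0 :=
  ext_inner_left ℂ fun h => by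
    rw [inner_mode_right, isHilbertSum_RT.OrthogonalFamily hij, inner_zero_right]

/-- Both sides are continuous and linear in `f`, so it suffices to compare them on the terms of the
Fourier expansion in `θ`. -/
theorem mode_opQ (a : ℝ) (j : ℤ) (f : L2RT) : mode j (opQ a f) = modeOp a j (mode j f) := by
  have hterm : ∀ (i : ℤ) (g : L2R), mode j (opQ a (tensorRT i g)) =
      modeOp a j (mode j (tensorRT i g)) := by
    intro i g
    rw [opQ_tensorRT]
    rcases eq_or_ne j i with rfl | hij
    · rw [mode_tensorRT_self, mode_tensorRT_self]
    · rw [mode_tensorRT_of_ne hij, mode_tensorRT_of_ne hij, map_zero]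
  have hsum := isHilbertSum_RT.hasSum_linearIsometryEquiv_symm
    (isHilbertSum_RT.linearIsometryEquiv f)
  rw [LinearIsometryEquiv.symm_apply_apply] at hsum
  have h1 := (mode j ∘L opQ a).hasSum hsum
  have h2 := (modeOp a j ∘L mode j).hasSum hsum
  refine h1.unique (h2.congr_fun ?_)
  exact fun i => hterm i _

/-! ### The Sobolev norm in terms of modes -/

theorem lintegral_measureRZ {F : ℝ × ℤ → ℝ≥0∞} (hF : Measurable F) :
    ∫⁻ p, F p ∂measureRZ = ∑' j : ℤ, ∫⁻ ξ, F (ξ, j) ∂measureFreq := by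
  rw [lintegral_prod_symm _ hF.aemeasurable, lintegral_count]

theorem memLp_slice (F : L2RZ) (j : ℤ) : MemLp (fun ξ => F (ξ, j)) 2 measureFreq := by
  have hm : Measurable (F : ℝ × ℤ → ℂ) := measurable_coeFn F
  refine ⟨(hm.comp measurable_prodMk_right).aestronglyMeasurable, ?_⟩
  rw [eLpNorm_lt_top_iff_lintegral_rpow_enorm_lt_top (by norm_num) (by norm_num)]
  simp only [ENNReal.toReal_ofNat, ENNReal.rpow_ofNat]
  have h1 : ∫⁻ p, ‖F p‖ₑ ^ 2 ∂measureRZ < ∞ := by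
    rw [lintegral_enorm_sq]
    simp
  rw [lintegral_measureRZ (hm.enorm.pow_const 2)] at h1
  exact (ENNReal.le_tsum j).trans_lt h1

theorem adjoint_tensorRZ (j : ℤ) (F : L2RZ) :
    ContinuousLinearMap.adjoint (tensorRZ j).toContinuousLinearMap F = (memLp_slice F j).toLp := by
  refine ext_inner_left ℂ fun h => ?_
  rw [ContinuousLinearMap.adjoint_inner_right, LinearIsometry.coe_toContinuousLinearMap,
    ← (tensorRZ j).inner_map_map, L2.inner_def, L2.inner_def]
  refine integral_congr_ae ?_
  filter_upwards [coeFn_tensorRZ j h, coeFn_tensorRZ j (memLp_slice F j).toLp,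
    Measure.quasiMeasurePreserving_fst.ae_eq (memLp_slice F j).coeFn_toLp] with p e1 e2 e3
  simp only [Function.comp_apply] at e3
  rw [e1, e2, e3]
  by_cases hp : p.2 = j
  · rw [if_pos hp, if_pos hp, ← hp]
  · rw [if_neg hp, if_neg hp, inner_zero_left, inner_zero_left]

/-- The transforms are unitary and intertwine `tensorRT j` with `tensorRZ j`, hence also the
adjoints: taking a mode corresponds to taking a slice. -/
theorem fourierR_mode (j : ℤ) (f : L2RT) :
    fourierR (mode j f) =ᵐ[measureFreq] fun ξ => fourierRT f (ξ, j) := by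
  have h : fourierR (mode j f) = (memLp_slice (fourierRT f) j).toLp := by
    rw [← adjoint_tensorRZ]
    refine ext_inner_left ℂ fun h => ?_
    obtain ⟨k, rfl⟩ := fourierR.surjective h
    rw [LinearIsometryEquiv.inner_map_map, inner_mode_right, ContinuousLinearMap.adjoint_inner_right,
      LinearIsometry.coe_toContinuousLinearMap, ← fourierRT_tensor,
      LinearIsometryEquiv.inner_map_map]
  rw [h]
  exact MemLp.coeFn_toLp _

theorem measurable_besselWeight (s : ℝ) : Measurable (besselWeight s) := by
  have : Measurable fun p : ℝ × ℤ => (p.2 : ℝ) := measurable_from_top.comp measurable_snd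
  unfold besselWeight
  fun_prop

theorem enorm_besselWeight_sq (s ξ : ℝ) (j : ℤ) :
    ‖(besselWeight s (ξ, j) : ℂ)‖ₑ ^ 2 = modeWeight s j (ξ / (2 * π)) := by
  rw [← ofReal_norm, ← ENNReal.ofReal_pow (norm_nonneg _), Complex.norm_real,
    Real.norm_of_nonneg (besselWeight_pos _ _).le, modeWeight, besselWeight,
    mul_div_cancel₀ ξ Real.two_pi_pos.ne', ← Real.rpow_mul_natCast (by positivity)]
  congr 2
  push_cast
  ring

/-- Tonelli over `ℝ × ℤ`, with `ξ = 2πη` on each slice. The Sobolev bound thereby reduces to one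
inequality per mode. -/
theorem lintegral_enorm_besselWeight_mul_sq (s : ℝ) (f : L2RT) :
    ∫⁻ p, ‖(besselWeight s p : ℂ) * fourierRT f p‖ₑ ^ 2 ∂measureRZ =
      ∑' j : ℤ, ∫⁻ η, modeWeight s j η * ‖fourierL2 (mode j f) η‖ₑ ^ 2 := by
  have hm : Measurable (fourierRT f : ℝ × ℤ → ℂ) := measurable_coeFn _
  have hw := measurable_besselWeight s
  rw [lintegral_measureRZ (by fun_prop)]
  refine tsum_congr fun j => ?_
  have hk : Measurable (fourierL2 (mode j f) : ℝ → ℂ) := measurable_coeFn _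
  have hmw : Measurable (modeWeight s j) := by
    unfold modeWeight
    fun_prop
  rw [← isL2Weight_toFreq.lintegral_eq (fun η => modeWeight s j η * ‖fourierL2 (mode j f) η‖ₑ ^ 2)
    (hmw.mul (hk.enorm.pow_const 2))]
  refine lintegral_congr_ae ?_
  filter_upwards [fourierR_mode j f, coeFn_fourierR (mode j f)] with ξ e1 e2
  rw [enorm_mul, mul_pow, enorm_besselWeight_sq, ← e1, e2]
  simp

theorem exists_lintegral_besselWeight_opQ_le {a s : ℝ} (hs₀ : 0 ≤ s) (hs₁ : s < 1 / 2)
    (ha : 2 * |a| * s < π) :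
    ∃ C : ℝ≥0∞, C ≠ ∞ ∧ ∀ f : L2RT,
      ∫⁻ p, ‖(besselWeight s p : ℂ) * fourierRT (opQ a f) p‖ₑ ^ 2 ∂measureRZ ≤
        C * ∫⁻ p, ‖(besselWeight s p : ℂ) * fourierRT f p‖ₑ ^ 2 ∂measureRZ := by
  obtain ⟨C, hC, hle⟩ := exists_lintegral_modeWeight_fourierL2_modeOp_le hs₀ hs₁ ha
  refine ⟨C, hC, fun f => ?_⟩
  rw [lintegral_enorm_besselWeight_mul_sq, lintegral_enorm_besselWeight_mul_sq,
    ← ENNReal.tsum_mul_left]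
  refine ENNReal.tsum_le_tsum fun j => ?_
  rw [mode_opQ]
  exact hle j _

theorem memLp_besselWeight_mul_iff (s : ℝ) (f : L2RT) :
    MemLp (fun p => (besselWeight s p : ℂ) * fourierRT f p) 2 measureRZ ↔
      ∫⁻ p, ‖(besselWeight s p : ℂ) * fourierRT f p‖ₑ ^ 2 ∂measureRZ < ∞ := by
  have hm : Measurable (fourierRT f : ℝ × ℤ → ℂ) := measurable_coeFn _
  have hw := measurable_besselWeight s
  rw [MemLp, eLpNorm_lt_top_iff_lintegral_rpow_enorm_lt_top (by norm_num) (by norm_num)]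
  simp only [ENNReal.toReal_ofNat, ENNReal.rpow_ofNat]
  exact and_iff_right (by fun_prop : Measurable _).aestronglyMeasurable

theorem Sobolev.enorm_sq {s : ℝ} (f : Sobolev s) :
    ‖f‖ₑ ^ 2 = ∫⁻ p, ‖(besselWeight s p : ℂ) * fourierRT f.toL2 p‖ₑ ^ 2 ∂measureRZ := by
  rw [← ofReal_norm, Sobolev.norm_eq, ← fourierRT.norm_map, ofReal_norm, ← lintegral_enorm_sq]
  refine lintegral_congr_ae ?_
  filter_upwards [fourierRT_besselPotential f] with p hp
  rw [hp]

end

end SobolevQ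

/-- For `|a| ≥ π` and `0 ≤ s < π / (2|a|)`, the operator `Q_a` maps `W^{s,2}(ℝ × 𝕋)` into itself, and
is bounded for the norm of `W^{s,2}(ℝ × 𝕋)`. -/
theorem theorem5p7 (a : ℝ) (ha : Real.pi ≤ |a|) (s : ℝ) (hs₀ : 0 ≤ s)
    (hs : s < Real.pi / (2 * |a|)) :
    ∃ Q : SobolevQ.Sobolev s →L[ℂ] SobolevQ.Sobolev s,
      ∀ f : SobolevQ.Sobolev s,
        SobolevQ.Sobolev.toL2 (Q f) = SobolevQ.opQ a (SobolevQ.Sobolev.toL2 f) := by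
  have ha0 : 0 < |a| := Real.pi_pos.trans_le ha
  rw [lt_div_iff₀ (by positivity)] at hs
  have hs' : 2 * |a| * s < Real.pi := by linarith
  -- Here `|a| ≥ π` gives `π / (2|a|) ≤ 1/2`, the range in which Hardy's inequality is used.
  have hs₁ : s < 1 / 2 := by
    by_contra! h
    nlinarith [mul_le_mul_of_nonneg_left h ha0.le]
  obtain ⟨C, hC, hle⟩ := SobolevQ.exists_lintegral_besselWeight_opQ_le hs₀ hs₁ hs'
  have hmem : ∀ f : SobolevQ.Sobolev s, SobolevQ.opQ a f.toL2 ∈ SobolevQ.sobolevSubmodule s := by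
    intro f
    refine (SobolevQ.memLp_besselWeight_mul_iff s _).2 ((hle f.toL2).trans_lt ?_)
    exact ENNReal.mul_lt_top hC.lt_top ((SobolevQ.memLp_besselWeight_mul_iff s _).1 f.memLp)
  let T : SobolevQ.Sobolev s →ₗ[ℂ] SobolevQ.Sobolev s :=
    LinearMap.codRestrict (SobolevQ.sobolevSubmodule s)
      ((SobolevQ.opQ a).toLinearMap ∘ₗ SobolevQ.Sobolev.toL2) hmem
  have hT : ∀ f, (T f).toL2 = SobolevQ.opQ a f.toL2 := fun f => rfl
  -- The estimate compares squared norms, hence the square root.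
  refine ⟨T.mkContinuous (√C.toReal) fun f => ?_, hT⟩
  have h1 : ‖T f‖ₑ ^ 2 ≤ C * ‖f‖ₑ ^ 2 := by
    rw [SobolevQ.Sobolev.enorm_sq, SobolevQ.Sobolev.enorm_sq, hT]
    exact hle _
  have h2 := ENNReal.toReal_mono (ENNReal.mul_ne_top hC (by simp)) h1
  simp only [ENNReal.toReal_pow, toReal_enorm, ENNReal.toReal_mul] at h2
  rw [← Real.sqrt_sq (norm_nonneg f), ← Real.sqrt_mul ENNReal.toReal_nonneg]
  exact Real.le_sqrt_of_sq_le h2
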